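/- **Setting.** Let $D\subset\mathbb R^p$ be open, $H$ a closed subspace of $L^2(D;\mathbb R^d)$ with its inner product $\langle\cdot,\cdot\rangle$ and norm $\|\cdot\|$, and $V$ a Banach space with norm $\|\cdot\|_V$. Let $A$ be a linear operator in $H$ with $D(A)\subset V\subset H$, all inclusions injective, $V\to H$ continuous, $D(A)$ dense in $V$ and (with the graph norm) densely and compactly embedded in $H$. Let $P_\lambda:V\to H$ be bounded linear operators depending continuously (in operator norm) on $\lambda$ in a neighbourhood $\Lambda$ of $\lambda_c$ containing $[\lambda_c,\lambda^*]$, $\lambda_c<\lambda^*$, and put $L_\lambda=-A+P_\lambda$ on $D(A)$. For $\lambda\in\Lambda$ let $(\boldsymbol e_n)_{n\ge1}=(\boldsymbol e_n(\lambda))_{n\ge 1}$ be an orthonormal basis of $H$ with $\boldsymbol e_n\in D(A)$, $L_\lambda\boldsymbol e_n=\beta_n(\lambda)\boldsymbol e_n$ and $\beta_1(\lambda)\ge\beta_2(\lambda)\ge\cdots$. Let $B:V\times V\to H$ be continuous and bilinear, $B_{ij}^n=\langle B(\boldsymbol e_i,\boldsymbol e_j),\boldsymbol e_n\rangle$. For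 $u\in V$ write $u=x\boldsymbol e_1+u_{\mathfrak s}$ with $x=\langle u,\boldsymbol e_1\rangle$. **(L1)** $L_\lambda$ is self-adjoint for $\lambda\in\Lambda$. For $\lambda\in\Lambda$, $\beta_1(\lambda)$ is $<0$, $=0$, $>0$ according as $\lambda<\lambda_c$, $\lambda=\lambda_c$, $\lambda>\lambda_c$, and $\beta_j(\lambda)<0$ for $j\ge2$, $\lambda\in[\lambda_c,\lambda^*]$. Moreover $A=-\Delta\,\mathrm{diag}(\boldsymbol\nu)$ with $\nu_1,\dots,\nu_d>0$, i.e. for $w\in D(A)$ the distribution $-\Delta\,\mathrm{diag}(\boldsymbol\nu)w$ lies in $L^2(D;\mathbb R^d)$ and $Aw$ is its orthogonal projection on $H$; $A$ is symmetric, $\langle Aw,w\rangle\ge0$ on $D(A)$, and $\|w\|_{\boldsymbol\nu}=\sqrt{\langle Aw,w\rangle}$ is a norm equivalent to $\|\cdot\|_V$. **(L2)** There are $\eta\in(0,1)$, $\delta>0$ such that for all $\lambda\in[\lambda_c,\lambda^*]$ and all $w\in D(A)$ with $\langle w,\boldsymbol e_1\rangle=0$: $\langle-\eta Aw+P_\lambda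 w,w\rangle\le-\delta\|w\|^2$ and $\langle-\eta Aw+P_\lambda w,Aw\rangle\le-\delta\|w\|_{\boldsymbol\nu}^2$. **(A3)** $\langle B(u,u),u\rangle=0$ for $u\in V$, and there is $N\ge1$ such that, for all $\lambda\in[\lambda_c,\lambda^*]$, $B_{11}^n=0$ for $n>N$ and $B_{11}^n\ne0$ for at least one $2\le n\le N$. Let $(\Omega,\mathbb P)$ be a probability space with a standard two-sided Brownian motion $(W_t)_{t\in\mathbb R}$ and a filtration $(\mathcal F_t)_{t\ge0}$ such that $W_s$ is $\mathcal F_t$-measurable for $s\le t$ and $W_{t'}-W_t$ is independent of $\mathcal F_t$ for $t'\ge t\ge0$. For $\lambda\in[\lambda_c,\lambda^*]$ put $\epsilon=\beta_1(\lambda)$, $\sigma=\sqrt\epsilon$ and $$M^{n}_{11}(t)=\int_{-\infty}^0e^{(2\epsilon-\beta_n(\lambda))s+\sigma(W_{t+s}-W_t)}\,ds,\qquad \Phi(X,t)=\sum_{n=2}^N B_{11}^nM_{11}^{n}(t)X^2\,\boldsymbol e_n .$$ **(P)** For every $\lambda\in[\lambda_c,\lambda^*]$, almost surely, $\sum_{n=2}^N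 B_{11}^nM_{11}^n(t)\,(B_{1n}^1+B_{n1}^1)<0$ for all $t\in\mathbb R$. **Equations.** Let $Z(t)=-\sigma\int_{-\infty}^0e^s(W_{t+s}-W_t)\,ds$, the stationary solution of $dr=-r\,dt+\sigma\,dW_t$. For each $\lambda\in(\lambda_c,\lambda^*]$ let $u$ be an adapted solution of $$du=(L_\lambda u+B(u,u))\,dt+\sigma u\circ dW_t$$ on $[0,\tau)$, $\tau\in(0,\infty]$ a stopping time, in the sense that, almost surely, $v=e^{-Z}u$ is a classical solution of $v'=L_\lambda v+Zv+e^{-Z}B(e^{Z}v,e^{Z}v)$ in $C((0,\tau);D(A))\cap C([0,\tau);V)\cap C^1((0,\tau);H)$; here $\tau$ is not shorter than the exit time from a fixed ball of $V$, i.e. for some $\rho>0$ independent of $\lambda$, almost surely $\sup_{[0,\tau)}\|u\|_V\ge\rho$ where $\tau<\infty$ (global solutions have $\tau=\infty$). Let $X$ be an adapted continuous solution on $[0,\infty)$, with $X(0)=x(0)$, of the reduced equation $$dX=\big(\epsilon X+X\,\langle B(\boldsymbol e_1,\Phi(X,t))+B(\Phi(X,t),\boldsymbol e_1),\boldsymbol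 e_1\rangle\big)dt+\sigma X\circ dW_t,$$ understood in the same way through $e^{-Z}X$. **Initial data.** Assume that for every $\chi'\in(0,1)$ there are $K>0$, $\epsilon_0>0$ such that for all $\lambda\in(\lambda_c,\lambda^*]$ with $\epsilon=\beta_1(\lambda)\le\epsilon_0$, with probability at least $1-\chi'$, $$|x(0)|\le K\sqrt\epsilon,\quad \|u_{\mathfrak s}(0)\|\le K\epsilon,\quad \|u_{\mathfrak s}(0)\|_V\le K\epsilon,\quad \|u_{\mathfrak s}(0)-\Phi(X(0),0)\|\le K\epsilon^{3/2}.$$ **Theorem.** Under (L1), (L2), (A3), (P) and the above, for every $T>0$ and $\chi\in(0,1)$ there are $\epsilon^*>0$ and $C>0$ such that for all $\lambda\in(\lambda_c,\lambda^*]$ with $\epsilon=\beta_1(\lambda)\le\epsilon^*$, $$\mathbb P\Big(\tau>\tfrac T\epsilon,\ \ \sup_{t\in[0,T/\epsilon]}|x(t)-X(t)|\le C\epsilon\ \text{ and }\ \sup_{t\in[0,T/\epsilon]}\|u_{\mathfrak s}(t)-\Phi(X(t),t)\|\le C\epsilon^{3/2}\Big)\ge1-\chi .$$ -/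

import Mathlib

open MeasureTheory ProbabilityTheory Filter Topology Set
open scoped NNReal ENNReal RealInnerProductSpace

noncomputable section

namespace PitchforkSPDE

/-! ### The concrete function space and the operator `-Δ diag(ν)` -/

/-- The space `L²(D; ℝᵈ)` over a set `D ⊆ ℝᵖ`. -/
abbrev VecL2 {p : ℕ} (D : Set (EuclideanSpace ℝ (Fin p))) (d : ℕ) : Type :=
  Lp (EuclideanSpace ℝ (Fin d)) 2 (volume.restrict D)

/-- `g = -Δ (diag(ν) u)` on the open set `D`, in the sense of distributions:
component by component, `∫ g_j φ = -ν_j ∫ u_j Δφ` for all test functions `φ ∈ C_c^∞(D)`. -/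
def IsNegDiagLaplacian {p d : ℕ} (D : Set (EuclideanSpace ℝ (Fin p))) (ν : Fin d → ℝ)
    (u g : VecL2 D d) : Prop :=
  ∀ (j : Fin d) (φ : EuclideanSpace ℝ (Fin p) → ℝ),
    ContDiff ℝ (⊤ : ℕ∞) φ → HasCompactSupport φ → tsupport φ ⊆ D →
      ∫ y in D, g y j * φ y = -(ν j * ∫ y in D, u y j * Laplacian.laplacian φ y)

/-! ### Two-sided Brownian motion -/

section Noise

variable {Ω : Type*} [mΩ : MeasurableSpace Ω]

/-- Standard two-sided real Brownian motion, indexed by `ℝ`. -/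
structure IsTwoSidedBrownian (W : ℝ → Ω → ℝ) (μ : Measure Ω) : Prop where
  zero : ∀ᵐ ω ∂μ, W 0 ω = 0
  indep : HasIndepIncrements W μ
  law : ∀ s t : ℝ, s ≤ t →
    HasLaw (fun ω => W t ω - W s ω) (gaussianReal 0 (Real.toNNReal (t - s))) μ
  cont : ∀ᵐ ω ∂μ, Continuous fun t => W t ω

/-- The filtration `𝓕` (indexed by `t ≥ 0`) is compatible with the two-sided motion `W`:
`𝓕 t` contains the whole past of `W` up to time `t`, and is independent of later increments. -/
structure IsCompatible (𝓕 : Filtration ℝ≥0 mΩ) (W : ℝ → Ω → ℝ)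
    (μ : Measure Ω) : Prop where
  past : ∀ (t : ℝ≥0) (s : ℝ), s ≤ t → Measurable[𝓕 t] (W s)
  future : ∀ s t : ℝ≥0, s ≤ t →
    Indep (𝓕 s) (MeasurableSpace.comap (fun ω => W t ω - W s ω) inferInstance) μ

/-- The stationary solution `Z(t) = -σ ∫_{-∞}^0 e^s (W_{t+s} - W_t) ds`
(that is, `σ ∫_{-∞}^t e^{-(t-s)} dW_s`) of the Langevin equation `dr = -r dt + σ dW`. -/
def ou (W : ℝ → Ω → ℝ) (σ t : ℝ) (ω : Ω) : ℝ :=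
  -σ * ∫ s in Iic (0 : ℝ), Real.exp s * (W (t + s) ω - W t ω)

end Noise

/-! ### The abstract evolution equation `du = (L_λ u + B(u,u)) dt + σ u ∘ dW` -/

/-- The interval `[0, τ)`, for a lifetime `τ ∈ [0, ∞]`. -/
def lifeSpan (τ : WithTop ℝ≥0) : Set ℝ :=
  {t : ℝ | 0 ≤ t ∧ ((Real.toNNReal t : ℝ≥0) : WithTop ℝ≥0) < τ}

/-- The data of the equation (the requirements on them follow below).
`A` is the principal part, an unbounded operator on `H` with domain `D(A)`, and
`D(A) ⊆ V ⊆ H` through the maps `incl` and `emb`; `P λ : V → H` is the lower order part and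
`B : V × V → H` the bilinear term, both bounded. `e λ n`, `β λ n` (`n = 1, 2, …`) are the
eigenvectors and eigenvalues of `L_λ = -A + P_λ`. The parameter `λ` ranges over a
neighbourhood `nhd` of the critical value `lamC`, and `lamS` is the number `λ^* > λ_c`. -/
structure Model (H V : Type*) [NormedAddCommGroup H] [InnerProductSpace ℝ H]
    [NormedAddCommGroup V] [NormedSpace ℝ V] where
  A : H →ₗ.[ℝ] H
  emb : V →L[ℝ] H
  incl : A.domain →ₗ[ℝ] V
  P : ℝ → V →L[ℝ] H
  B : V →L[ℝ] V →L[ℝ] H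
  nhd : Set ℝ
  lamC : ℝ
  lamS : ℝ
  e : ℝ → ℕ+ → A.domain
  β : ℝ → ℕ+ → ℝ

namespace Model

section Deterministic

variable {H V : Type*} [NormedAddCommGroup H] [InnerProductSpace ℝ H]
  [NormedAddCommGroup V] [NormedSpace ℝ V] (m : Model H V)

/-- `L_λ = -A + P_λ` with domain `D(A)`. -/
def L (lam : ℝ) : H →ₗ.[ℝ] H where
  domain := m.A.domain
  toFun := -m.A.toFun + (m.P lam).toLinearMap ∘ₗ m.incl

/-- `e_n`, as an element of `V`. -/
def eV (lam : ℝ) (n : ℕ+) : V := m.incl (m.e lam n)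

/-- `B_{ij}^n = ⟨B(e_i, e_j), e_n⟩`. -/
def coeff (lam : ℝ) (i j n : ℕ+) : ℝ :=
  ⟪m.B (m.eV lam i) (m.eV lam j), (m.e lam n : H)⟫

/-- The amplitude `x = ⟨u, e_1⟩` of the critical mode. -/
def low (lam : ℝ) (u : V) : ℝ := ⟪m.emb u, (m.e lam 1 : H)⟫

/-- The high-mode part `u_s = Π_s u = u - ⟨u, e_1⟩ e_1`. -/
def high (lam : ℝ) (u : V) : V := u - m.low lam u • m.eV lam 1

/-- `F_c(v) = ⟨B(e_1, v) + B(v, e_1), e_1⟩`. -/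
def Fc (lam : ℝ) (v : V) : ℝ :=
  ⟪m.B (m.eV lam 1) v + m.B v (m.eV lam 1), (m.e lam 1 : H)⟫

/-- The functional setting: `D(A) ⊆ V ⊆ H` with continuous injections, `D(A)` dense in `V` and
densely and compactly embedded in `H`, `λ ↦ P_λ` continuous, and `(e_n(λ))` an orthonormal
basis of `H` made of eigenvectors of `L_λ`, the eigenvalues being listed in decreasing order
(with multiplicity). -/
structure FunctionalSetting : Prop where
  emb_inj : Function.Injective m.emb
  emb_incl : ∀ u : m.A.domain, m.emb (m.incl u) = (u : H)
  incl_dense : DenseRange m.incl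
  dense : Dense (m.A.domain : Set H)
  compact : IsCompact (closure
    ((fun u : m.A.domain => (u : H)) '' {u : m.A.domain | ‖(u : H)‖ + ‖m.A u‖ ≤ 1}))
  nhd_mem : m.nhd ∈ 𝓝 m.lamC
  lamC_lt : m.lamC < m.lamS
  Icc_subset : Icc m.lamC m.lamS ⊆ m.nhd
  P_cont : ContinuousOn m.P m.nhd
  orthonormal : ∀ lam ∈ m.nhd, Orthonormal ℝ fun n : ℕ+ => (m.e lam n : H)
  total : ∀ lam ∈ m.nhd,
    (Submodule.span ℝ (range fun n : ℕ+ => (m.e lam n : H))).topologicalClosure = ⊤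
  eigen : ∀ lam ∈ m.nhd, ∀ n : ℕ+, m.L lam (m.e lam n) = m.β lam n • (m.e lam n : H)
  ordered : ∀ lam ∈ m.nhd, Antitone (m.β lam)

/-- `L_λ` is self-adjoint. -/
def CondA1 [CompleteSpace H] : Prop := ∀ lam ∈ m.nhd, IsSelfAdjoint (m.L lam)

/-- Principle of exchange of stabilities with a single critical mode, all other eigenvalues
staying negative on `[λ_c, λ^*]`. -/
structure CondA2 : Prop where
  neg : ∀ lam ∈ m.nhd, lam < m.lamC → m.β lam 1 < 0
  crit : m.β m.lamC 1 = 0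
  pos : ∀ lam ∈ m.nhd, m.lamC < lam → 0 < m.β lam 1
  stable : ∀ lam ∈ Icc m.lamC m.lamS, ∀ j : ℕ+, 2 ≤ j → m.β lam j < 0

/-- Energy conservation, and finite interaction of the critical mode with the stable modes
(`B` is a continuous bilinear map `V × V → H` by construction). -/
structure CondA3 (N : ℕ+) : Prop where
  energy : ∀ u : V, ⟪m.B u u, m.emb u⟫ = 0
  finite : ∀ lam ∈ Icc m.lamC m.lamS, ∀ n : ℕ+, N < n → m.coeff lam 1 1 n = 0
  nontrivial : ∀ lam ∈ Icc m.lamC m.lamS, ∃ n : ℕ+, 2 ≤ n ∧ n ≤ N ∧ m.coeff lam 1 1 n ≠ 0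

/-- Uniform linear damping of the stable modes. -/
def CondL2 : Prop :=
  ∃ η ∈ Ioo (0 : ℝ) 1, ∃ δ > (0 : ℝ), ∀ lam ∈ Icc m.lamC m.lamS, ∀ w : m.A.domain,
    ⟪(w : H), (m.e lam 1 : H)⟫ = 0 →
      ⟪-(η • m.A w) + m.P lam (m.incl w), (w : H)⟫ ≤ -δ * ‖(w : H)‖ ^ 2 ∧
      ⟪-(η • m.A w) + m.P lam (m.incl w), m.A w⟫ ≤ -δ * ⟪m.A w, (w : H)⟫

end Deterministic

/-- Conditions on the linear part: `H` is a closed subspace of `L²(D; ℝᵈ)`, `L_λ` satisfies the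
two spectral conditions above, and `A = -Δ diag(ν)` with `ν_j > 0` (`A w` is the orthogonal
projection on `H` of the distribution `-Δ diag(ν) w ∈ L²(D; ℝᵈ)`, thus equal to it whenever the
latter belongs to `H`; boundary conditions are part of `D(A)`). Integration by parts is allowed:
`A` is symmetric, and `⟨A w, w⟩` is the square of a norm equivalent to that of `V`
(on the dense subspace `D(A)` of `V`, hence on `V`). -/
structure CondL1 {p d : ℕ} {D : Set (EuclideanSpace ℝ (Fin p))} (ν : Fin d → ℝ)
    {H : Submodule ℝ (VecL2 D d)} [CompleteSpace H]
    {V : Type*} [NormedAddCommGroup V] [NormedSpace ℝ V] (m : Model H V) : Prop where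
  condA1 : m.CondA1
  condA2 : m.CondA2
  ν_pos : ∀ j, 0 < ν j
  laplacian : ∀ w : m.A.domain, ∃ g : VecL2 D d,
    IsNegDiagLaplacian D ν ((w : H) : VecL2 D d) g ∧
      ∀ h : H, ⟪m.A w, h⟫ = ⟪g, (h : VecL2 D d)⟫
  symm : ∀ w z : m.A.domain, ⟪m.A w, (z : H)⟫ = ⟪(w : H), m.A z⟫
  equiv_norm : ∃ c > (0 : ℝ), ∃ C > (0 : ℝ), ∀ w : m.A.domain,
    c * ‖m.incl w‖ ^ 2 ≤ ⟪m.A w, (w : H)⟫ ∧ ⟪m.A w, (w : H)⟫ ≤ C * ‖m.incl w‖ ^ 2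

section Stochastic

variable {H V : Type*} [NormedAddCommGroup H] [InnerProductSpace ℝ H]
  [NormedAddCommGroup V] [NormedSpace ℝ V] (m : Model H V)
  {Ω : Type*} [mΩ : MeasurableSpace Ω]

/-- `σ = √ε` with `ε = β_1(λ)`. -/
def noise (lam : ℝ) : ℝ := √(m.β lam 1)

/-- The non-Markovian coefficient
`M_{11}^n(t) = ∫_{-∞}^0 exp((2 β_1 - β_n) s + σ (W_{t+s} - W_t)) ds`, with `σ = √ε`. -/
def Mterm (W : ℝ → Ω → ℝ) (lam : ℝ) (n : ℕ+) (t : ℝ) (ω : Ω) : ℝ :=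
  ∫ s in Iic (0 : ℝ),
    Real.exp ((2 * m.β lam 1 - m.β lam n) * s + m.noise lam * (W (t + s) ω - W t ω))

/-- The parameterization `Φ(X, t, ω) = ∑_{n=2}^N B_{11}^n M_{11}^n(t, ω) X² e_n`. -/
def Phi (N : ℕ+) (W : ℝ → Ω → ℝ) (lam X t : ℝ) (ω : Ω) : V :=
  ∑ n ∈ Finset.Icc 2 N, (m.coeff lam 1 1 n * m.Mterm W lam n t ω * X ^ 2) • m.eV lam n

/-- The dissipation condition on the cubic coefficient of the reduced equation. -/
def CondP (N : ℕ+) (W : ℝ → Ω → ℝ) (μ : Measure Ω) : Prop :=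
  ∀ lam ∈ Icc m.lamC m.lamS, ∀ᵐ ω ∂μ, ∀ t : ℝ,
    ∑ n ∈ Finset.Icc 2 N,
      m.coeff lam 1 1 n * m.Mterm W lam n t ω * (m.coeff lam 1 n 1 + m.coeff lam n 1 1) < 0

/-- `u` is a solution on `[0, τ)` of the SPDE `du = (L_λ u + B(u,u)) dt + σ u ∘ dW`, `σ = √ε`:
`τ > 0` is a stopping time, `u` is adapted, and almost surely `v = e^{-Z} u` is a classical
solution of `v' = L_λ v + Z v + e^{-Z} B(e^Z v, e^Z v)` belonging to
`C((0,τ); D(A)) ∩ C([0,τ); V) ∩ C¹((0,τ); H)`. Here `g = A v`. -/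
structure IsSPDESolution (𝓕 : Filtration ℝ≥0 mΩ) (W : ℝ → Ω → ℝ)
    (μ : Measure Ω) (lam : ℝ) (u : ℝ → Ω → V) (τ : Ω → WithTop ℝ≥0) : Prop where
  stopping : IsStoppingTime 𝓕 τ
  pos : ∀ᵐ ω ∂μ, 0 < τ ω
  adapted : ∀ t : ℝ≥0, StronglyMeasurable[𝓕 t]
    ({ω | (t : WithTop ℝ≥0) < τ ω}.indicator fun ω => m.emb (u t ω))
  classical : ∀ᵐ ω ∂μ, ∃ (v : ℝ → V) (g : ℝ → H),
    (∀ t ∈ lifeSpan (τ ω), v t = Real.exp (-ou W (m.noise lam) t ω) • u t ω) ∧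
    ContinuousOn v (lifeSpan (τ ω)) ∧
    ContinuousOn g (lifeSpan (τ ω) ∩ Ioi 0) ∧
    ∀ t ∈ lifeSpan (τ ω) ∩ Ioi 0,
      (m.emb (v t), g t) ∈ m.A.graph ∧
      HasDerivAt (fun s => m.emb (v s))
        (-g t + m.P lam (v t) + ou W (m.noise lam) t ω • m.emb (v t)
          + Real.exp (-ou W (m.noise lam) t ω) •
              m.B (Real.exp (ou W (m.noise lam) t ω) • v t)
                (Real.exp (ou W (m.noise lam) t ω) • v t)) t

/-- The lifetime `τ` is not shorter than the exit time of `u` from the ball of radius `ρ` of `V`: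
where `τ < ∞`, `sup_{[0,τ)} ‖u‖_V ≥ ρ`. -/
def SurvivesInBall (μ : Measure Ω) (ρ : ℝ) (u : ℝ → Ω → V) (τ : Ω → WithTop ℝ≥0) : Prop :=
  ∀ᵐ ω ∂μ, τ ω ≠ ⊤ → ∀ r < ρ, ∃ t ∈ lifeSpan (τ ω), r < ‖u t ω‖

/-- `X` solves, on `[0, ∞)`, the reduced equation
`dX = (ε X + X F_c(Φ(X, t))) dt + σ X ∘ dW`, `σ = √ε`, in the same sense:
`X` is adapted and almost surely continuous, and `U = e^{-Z} X` solves
`U' = ε U + Z U + e^{-Z} X F_c(Φ(X, t))`. -/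
structure IsReducedSolution (N : ℕ+) (𝓕 : Filtration ℝ≥0 mΩ) (W : ℝ → Ω → ℝ)
    (μ : Measure Ω) (lam : ℝ) (X : ℝ → Ω → ℝ) : Prop where
  adapted : ∀ t : ℝ≥0, StronglyMeasurable[𝓕 t] (X t)
  cont : ∀ᵐ ω ∂μ, ContinuousOn (fun t => X t ω) (Ici 0)
  ode : ∀ᵐ ω ∂μ, ∀ t > 0,
    HasDerivAt (fun s => Real.exp (-ou W (m.noise lam) s ω) * X s ω)
      (m.β lam 1 * (Real.exp (-ou W (m.noise lam) t ω) * X t ω)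
        + ou W (m.noise lam) t ω * (Real.exp (-ou W (m.noise lam) t ω) * X t ω)
        + Real.exp (-ou W (m.noise lam) t ω)
            * (X t ω * m.Fc lam (m.Phi N W lam (X t ω) t ω))) t

end Stochastic

end Model

end PitchforkSPDE

end

open PitchforkSPDE

noncomputable section

namespace PitchforkSPDE

/-! ### Linear growth of Brownian paths -/

/-! The noise is removed path by path. With `g = σ W`, the function `w = e^{-g} u` solves `w' = L_λ
w + e^g B(w, w)`, an equation whose only randomness is the scalar factor `e^g`. By Brownian scaling,
`√ε W(·/ε)` again has Brownian increments, so outside an event of small probability `|σ W_t| ≤ R (1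
+ ε|t|)` for all `t`, with `R` independent of `ε` (`exists_linear_growth_bound`). On the complement
`e^g` is bounded on `[0, T/ε]`, the integrals `M_{11}^n` are bounded there, and the rest is
deterministic (`exists_pathwise_bound`).

Put `s = √ε`. Energy conservation removes `B` from the balance for `‖w‖²`, which therefore grows at
most like `e^{2εt}`: up to time `T/ε` the amplitude stays `O(s)`. A barrier for `⟨A w_s, w_s⟩` then
keeps the stable part `O(s²)` in `V` (`norm_high_sq_le`), so `u` remains in the small ball and
survives past `T/ε`.

Let `f = B(e_1, e_1)` and `Y = e^{-g} X`. The sum `ψ = ∑ B_{11}^n (e^g M_{11}^n) e_n` solves `ψ' =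
(L_λ - 2ε) ψ + e^g f`, so `Y² ψ`, which is `e^{-g} Φ(X)`, solves the high-mode equation up to higher
order. Polarised energy conservation gives `F_c(v) = -⟨f, v⟩`; since `⟨f, ψ⟩` is a sum of squares
with nonnegative weights, the cubic term of the reduced equation is dissipative.

The errors `z = ⟨w, e_1⟩ - Y` and `r = w_s - Y² ψ` form a slow-fast pair: `z` has growth rate `s²`
and is driven by `s‖r‖` and `s⁴`; `‖r‖` is damped at rate `δ` and driven by `s|z|` and `s³`. Over a
time `T/s²` this yields `z = O(s²)` and `r = O(s³)` (`slow_fast_estimate`,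
`exists_comparison_bound`), and multiplication by the bounded factor `e^g` returns to `u` and `X`.
-/

/-- Dyadic chaining: control of all dyadic increments of a continuous function controls its
oscillation. -/
lemma abs_sub_le_of_dyadic {f : ℝ → ℝ} (hf : Continuous f) {a h r q : ℝ} (hh : 0 < h)
    (hr : 0 ≤ r) (hq0 : 0 ≤ q) (hq1 : q < 1)
    (H : ∀ j k : ℕ, k < 2 ^ j →
      |f (a + h * (k + 1) / 2 ^ j) - f (a + h * k / 2 ^ j)| ≤ r * q ^ j)
    {s : ℝ} (hs : s ∈ Icc a (a + h)) : |f s - f a| ≤ r / (1 - q) := by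
  have key : ∀ j k : ℕ, k ≤ 2 ^ j →
      |f (a + h * k / 2 ^ j) - f a| ≤ r * ∑ i ∈ Finset.range (j + 1), q ^ i := by
    intro j
    induction j with
    | zero =>
      intro k hk
      have hk' : k = 0 ∨ k = 1 := by simp at hk; omega
      rcases hk' with rfl | rfl
      · simpa using hr
      · have := H 0 0 (by norm_num)
        simpa using this
    | succ j ih =>
      intro k hk
      rw [Finset.sum_range_succ, mul_add]
      have hq : 0 ≤ r * q ^ (j + 1) := by positivity
      -- A point with even numerator already belongs to level `j`; one with odd numerator lies a
      -- single increment of level `j + 1` to the right of such a point.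
      rcases Nat.even_or_odd' k with ⟨l, rfl | rfl⟩
      · have h1 := ih l (by rw [pow_succ] at hk; omega)
        have h2 : a + h * ((2 * l : ℕ) : ℝ) / 2 ^ (j + 1) = a + h * l / 2 ^ j := by
          push_cast; rw [pow_succ]; field_simp
        rw [h2]; linarith
      · have h1 := ih l (by rw [pow_succ] at hk; omega)
        have h2 : a + h * ((2 * l : ℕ) : ℝ) / 2 ^ (j + 1) = a + h * l / 2 ^ j := by
          push_cast; rw [pow_succ]; field_simp
        have h3 := H (j + 1) (2 * l) (by omega)
        rw [h2] at h3
        have h4 := abs_sub_le (f (a + h * ((2 * l + 1 : ℕ) : ℝ) / 2 ^ (j + 1)))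
          (f (a + h * l / 2 ^ j)) (f a)
        push_cast at h3 h4 ⊢
        linarith
  have key2 : ∀ j k : ℕ, k ≤ 2 ^ j → |f (a + h * k / 2 ^ j) - f a| ≤ r / (1 - q) := by
    intro j k hk
    refine (key j k hk).trans ?_
    rw [div_eq_mul_inv]
    refine mul_le_mul_of_nonneg_left ?_ hr
    rw [← tsum_geometric_of_lt_one hq0 hq1]
    exact (summable_geometric_of_lt_one hq0 hq1).sum_le_tsum _ (fun i _ => by positivity)
  set x := (s - a) / h with hx
  have hx0 : 0 ≤ x := div_nonneg (by linarith [hs.1]) hh.le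
  have hx1 : x ≤ 1 := by rw [hx, div_le_one hh]; linarith [hs.2]
  have hxs : a + h * x = s := by rw [hx]; field_simp; ring
  -- Dyadic points below `x` converge to it, so continuity extends the bound from dyadic points to
  -- all of the interval.
  have hlim : Tendsto (fun j : ℕ => ((⌊x * (2 : ℝ) ^ j⌋₊ : ℝ) / (2 : ℝ) ^ j)) atTop (𝓝 x) :=
    (tendsto_nat_floor_mul_div_atTop hx0).comp
      (tendsto_pow_atTop_atTop_of_one_lt (by norm_num : (1 : ℝ) < 2))
  have hlim2 : Tendsto (fun j : ℕ => |f (a + h * (⌊x * (2 : ℝ) ^ j⌋₊ : ℝ) / (2 : ℝ) ^ j) - f a|)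
      atTop (𝓝 (|f s - f a|)) := by
    have hc : Continuous fun x => |f (a + h * x) - f a| := by fun_prop
    have := (hc.tendsto x).comp hlim
    rw [hxs] at this
    refine this.congr fun j => ?_
    simp only [Function.comp, mul_div_assoc]
  refine le_of_tendsto' hlim2 fun j => key2 j _ ?_
  have : x * (2 : ℝ) ^ j ≤ ((2 ^ j : ℕ) : ℝ) := by
    push_cast
    exact mul_le_of_le_one_left (by positivity) hx1
  exact Nat.floor_le_of_le this

/-- The fourth moment of the standard normal distribution. -/
def gaussMoment : ℝ≥0∞ := ∫⁻ x, ENNReal.ofReal (x ^ 4) ∂(gaussianReal 0 1)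

lemma gaussMoment_lt_top : gaussMoment < ∞ := by
  have h : MemLp id 4 (gaussianReal 0 1) := memLp_id_gaussianReal 4
  have h2 : Integrable (fun x : ℝ => ‖id x‖ ^ 4) (gaussianReal 0 1) :=
    h.integrable_norm_pow (p := 4) (by norm_num)
  have h3 := h2.lintegral_lt_top
  refine lt_of_eq_of_lt ?_ h3
  unfold gaussMoment
  congr 1; ext x
  simp only [id, Real.norm_eq_abs]
  rw [show |x| ^ 4 = x ^ 4 from Even.pow_abs (by decide) x]

/-- Markov's inequality for the fourth power. The second moment would not do for chaining: `2^j`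
increments of variance proportional to `2^{-j}` leave no decay in `j`. -/
lemma gaussianReal_tail (v : ℝ≥0) {x : ℝ} (hx : 0 < x) :
    gaussianReal 0 v {y | x ≤ |y|} ≤ ENNReal.ofReal ((v : ℝ) ^ 2 / x ^ 4) * gaussMoment := by
  have hmap : (gaussianReal 0 1).map (fun y => √v * y) = gaussianReal 0 v := by
    rw [gaussianReal_map_const_mul]
    congr 1
    · simp
    · ext; simp
  rw [← hmap, Measure.map_apply (by fun_prop)
    (measurableSet_le measurable_const (by fun_prop))]
  have h1 := mul_meas_ge_le_lintegral (μ := gaussianReal 0 1)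
    (f := fun y => ENNReal.ofReal ((v : ℝ) ^ 2 / x ^ 4) * ENNReal.ofReal (y ^ 4))
    (by fun_prop) 1
  rw [one_mul, lintegral_const_mul _ (by fun_prop)] at h1
  refine le_trans (measure_mono ?_) h1
  intro y hy
  simp only [mem_preimage, mem_ofPred_eq] at hy ⊢
  rw [← ENNReal.ofReal_mul (by positivity), ← ENNReal.ofReal_one]
  apply ENNReal.ofReal_le_ofReal
  rw [div_mul_eq_mul_div, one_le_div (by positivity)]
  have h3 : x ^ 4 ≤ |√v * y| ^ 4 := pow_le_pow_left₀ hx.le hy 4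
  rw [show |√v * y| ^ 4 = (√v * y) ^ 4 from Even.pow_abs (by decide) _, mul_pow] at h3
  have : √(v : ℝ) ^ 4 = (v : ℝ) ^ 2 := by
    rw [show (4 : ℕ) = 2 * 2 from rfl, pow_mul, Real.sq_sqrt v.coe_nonneg]
  rwa [this] at h3

/-- A continuous process with Brownian increments. -/
structure HasBrownianIncrements {Ω : Type*} [MeasurableSpace Ω] (Y : ℝ → Ω → ℝ) (μ : Measure Ω) :
    Prop where
  zero : ∀ᵐ ω ∂μ, Y 0 ω = 0
  law : ∀ s t : ℝ, s ≤ t →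
    HasLaw (fun ω => Y t ω - Y s ω) (gaussianReal 0 (Real.toNNReal (t - s))) μ
  cont : ∀ᵐ ω ∂μ, Continuous fun t => Y t ω

section

variable {Ω : Type*} [MeasurableSpace Ω] {μ : Measure Ω} {Y : ℝ → Ω → ℝ}

/-- Brownian scaling turns a growth bound for one process into bounds on the slow time scale `t/ε`
whose constant does not depend on `ε`. -/
lemma HasBrownianIncrements.scale {W : ℝ → Ω → ℝ} (hW : HasBrownianIncrements W μ) {ε : ℝ}
    (hε : 0 < ε) : HasBrownianIncrements (fun t ω => √ε * W (t / ε) ω) μ where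
  zero := by filter_upwards [hW.zero] with ω h; simp [h]
  law s t hst := by
    have h := gaussianReal_const_mul (hW.law (s / ε) (t / ε) (by gcongr)) √ε
    convert! h using 2
    · ring
    · simp
    · ext
      have h1 : 0 ≤ t / ε - s / ε := by rw [← sub_div]; exact div_nonneg (by linarith) hε.le
      simp only [Real.coe_toNNReal _ (sub_nonneg.2 hst), NNReal.coe_mul, Real.coe_toNNReal _ h1,
        NNReal.coe_mk, Real.sq_sqrt hε.le]
      field_simp
  cont := by
    filter_upwards [hW.cont] with ω h
    exact continuous_const.mul (h.comp (continuous_id.div_const ε))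

lemma HasBrownianIncrements.measure_increment_le (hY : HasBrownianIncrements Y μ) {s h x : ℝ}
    (hh : 0 ≤ h) (hx : 0 < x) :
    μ {ω | x ≤ |Y (s + h) ω - Y s ω|} ≤ ENNReal.ofReal (h ^ 2 / x ^ 4) * gaussMoment := by
  have hl := hY.law s (s + h) (by linarith)
  have h1 := gaussianReal_tail (Real.toNNReal (s + h - s)) hx
  rw [← hl.map_eq, Measure.map_apply_of_aemeasurable hl.aemeasurable
    (measurableSet_le measurable_const (by fun_prop)),
    Real.coe_toNNReal _ (by linarith), add_sub_cancel_left] at h1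
  exact h1

/-- Maximal inequality for processes with Brownian increments. -/
lemma HasBrownianIncrements.measure_oscillation_le (hY : HasBrownianIncrements Y μ)
    (a : ℝ) {h r : ℝ} (hh : 0 < h) (hr : 0 < r) :
    μ {ω | ¬ ∀ s ∈ Icc a (a + h), |Y s ω - Y a ω| ≤ 10 * r} ≤
      ENNReal.ofReal (5 * h ^ 2 / r ^ 4) * gaussMoment := by
  set bad : ℕ → Set Ω := fun j => ⋃ k ∈ Finset.range (2 ^ j),
    {ω | r * (9 / 10) ^ j ≤ |Y (a + h * k / 2 ^ j + h / 2 ^ j) ω - Y (a + h * k / 2 ^ j) ω|}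
    with hbad
  have hsub : {ω | ¬ ∀ s ∈ Icc a (a + h), |Y s ω - Y a ω| ≤ 10 * r} ≤ᵐ[μ] ⋃ j, bad j := by
    filter_upwards [hY.cont] with ω hc hω
    by_contra hno
    apply hω
    intro s hs
    have hcon : ∀ j k : ℕ, k < 2 ^ j →
        |Y (a + h * (k + 1) / 2 ^ j) ω - Y (a + h * k / 2 ^ j) ω| ≤ r * (9 / 10) ^ j := by
      intro j k hk
      by_contra hlt
      apply hno
      refine mem_iUnion.2 ⟨j, ?_⟩
      simp only [hbad, mem_iUnion, Finset.mem_range]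
      refine ⟨k, hk, ?_⟩
      have e : a + h * k / 2 ^ j + h / 2 ^ j = a + h * (k + 1) / 2 ^ j := by ring
      simp only [mem_ofPred_eq, e]
      exact (not_le.1 hlt).le
    have := abs_sub_le_of_dyadic hc hh hr.le (by norm_num) (by norm_num) hcon hs
    calc _ ≤ r / (1 - 9 / 10) := this
      _ = 10 * r := by ring
  refine (measure_mono_ae hsub).trans ((measure_iUnion_le _).trans ?_)
  -- Level `j` contributes `2^j (h/2^j)² / (r q^j)⁴ = (h²/r⁴) c^j` with `q = 9/10`. Convergence
  -- needs `q⁴ > 1/2`; for this `q` the geometric series is at most `5`, and the chaining factor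
  -- `1/(1 - q)` is `10`.
  set c : ℝ := 1 / (2 * (9 / 10) ^ 4) with hc
  have hc0 : 0 ≤ c := by rw [hc]; positivity
  have hc1 : c < 1 := by rw [hc]; norm_num
  have hj : ∀ j, μ (bad j) ≤ ENNReal.ofReal (h ^ 2 / r ^ 4 * c ^ j) * gaussMoment := by
    intro j
    refine (measure_biUnion_finset_le _ _).trans ?_
    refine (Finset.sum_le_sum fun (k : ℕ) _ => hY.measure_increment_le (s := a + h * k / 2 ^ j)
      (h := h / 2 ^ j) (x := r * (9 / 10) ^ j) (by positivity) (by positivity)).trans ?_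
    rw [Finset.sum_const, Finset.card_range, nsmul_eq_mul, ← mul_assoc]
    gcongr
    rw [← ENNReal.ofReal_natCast, ← ENNReal.ofReal_mul (by positivity)]
    apply ENNReal.ofReal_le_ofReal
    apply le_of_eq
    have e : c ^ j = 1 / (2 ^ j * ((9 / 10) ^ j) ^ 4) := by
      rw [hc, one_div, inv_pow, mul_pow, ← pow_mul, mul_comm 4 j, pow_mul, one_div]
    rw [e]
    push_cast
    generalize ((9 : ℝ) / 10) ^ j = y
    field_simp
  refine (ENNReal.tsum_le_tsum hj).trans ?_
  rw [ENNReal.tsum_mul_right]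
  gcongr
  rw [← ENNReal.ofReal_tsum_of_nonneg (fun j => by positivity)
    ((summable_geometric_of_lt_one hc0 hc1).mul_left _), tsum_mul_left,
    tsum_geometric_of_lt_one hc0 hc1]
  apply ENNReal.ofReal_le_ofReal
  have : (1 - c)⁻¹ ≤ 5 := by rw [hc]; norm_num
  calc h ^ 2 / r ^ 4 * (1 - c)⁻¹ ≤ h ^ 2 / r ^ 4 * 5 := by gcongr
    _ = _ := by ring

/-- Linear growth of Brownian paths, with a probability bound that depends only on the constant. -/
lemma exists_linear_growth_bound {χ : ℝ} (hχ : 0 < χ) :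
    ∃ R > (0 : ℝ), ∀ {Ω : Type*} [MeasurableSpace Ω] (μ : Measure Ω) (Y : ℝ → Ω → ℝ),
      HasBrownianIncrements Y μ →
        μ {ω | ¬ ∀ s, |Y s ω| ≤ R * (1 + |s|)} ≤ ENNReal.ofReal χ := by
  set κ := gaussMoment.toReal with hκ
  have hκ' : gaussMoment = ENNReal.ofReal κ := (ENNReal.ofReal_toReal gaussMoment_lt_top.ne).symm
  have hκ0 : 0 ≤ κ := ENNReal.toReal_nonneg
  -- The bad events below have total probability at most `160 κ / ρ⁴`, and `ρ ≤ ρ⁴` makes this at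
  -- most `χ`.
  obtain ⟨ρ, hρ1, hρ⟩ : ∃ ρ : ℝ, 1 ≤ ρ ∧ 160 * κ ≤ χ * ρ := by
    refine ⟨max 1 (160 * κ / χ), le_max_left _ _, ?_⟩
    calc 160 * κ = χ * (160 * κ / χ) := by field_simp
      _ ≤ _ := by gcongr; exact le_max_right _ _
  refine ⟨20 * ρ, by positivity, ?_⟩
  intro Ω _ μ Y hY
  set bad : ℕ → Set Ω := fun k => {ω | ¬ ∀ s ∈ Icc (-(2 : ℝ) ^ (k + 1))
    (-(2 : ℝ) ^ (k + 1) + 4 * 2 ^ k), |Y s ω - Y (-(2 : ℝ) ^ (k + 1)) ω| ≤ 10 * (ρ * 2 ^ k)}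
  have hsub : {ω | ¬ ∀ s, |Y s ω| ≤ 20 * ρ * (1 + |s|)} ≤ᵐ[μ] ⋃ j, bad j := by
    filter_upwards [hY.zero] with ω h0 hω
    by_contra hno
    apply hω
    intro s
    -- On `[-2^{k+1}, 2^{k+1}]` the oscillation is measured from the left endpoint; comparison with
    -- the value `0` at time `0` doubles the constant `10` to `20`.
    have hgood : ∀ k : ℕ, |s| ≤ 2 ^ (k + 1) → |Y s ω| ≤ 20 * ρ * 2 ^ k := by
      intro k hk
      have hnb : ω ∉ bad k := fun hb => hno (mem_iUnion.2 ⟨k, hb⟩)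
      simp only [bad, mem_ofPred_eq, not_not] at hnb
      have e : -(2 : ℝ) ^ (k + 1) + 4 * 2 ^ k = 2 ^ (k + 1) := by rw [pow_succ]; ring
      rw [e] at hnb
      have h1 := hnb s ⟨(abs_le.1 hk).1, (abs_le.1 hk).2⟩
      have h2 := hnb 0 ⟨by simp, by positivity⟩
      rw [h0] at h2
      have h3 := abs_sub_le (Y s ω) (Y (-(2 : ℝ) ^ (k + 1)) ω) 0
      rw [abs_sub_comm] at h2
      rw [sub_zero] at h3 h2
      rw [sub_zero] at h3
      linarith
    rcases le_total |s| 1 with hs | hs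
    · have := hgood 0 (by norm_num; linarith)
      simp only [pow_zero, mul_one] at this
      refine this.trans ?_
      nlinarith [abs_nonneg s]
    · obtain ⟨k, hk1, hk2⟩ := exists_nat_pow_near hs (by norm_num : (1 : ℝ) < 2)
      refine (hgood k hk2.le).trans ?_
      gcongr
      linarith
  refine (measure_mono_ae hsub).trans ((measure_iUnion_le _).trans ?_)
  have hk : ∀ k, μ (bad k) ≤ ENNReal.ofReal (80 * κ / ρ ^ 4 * (1 / 2) ^ k) := by
    intro k
    refine (hY.measure_oscillation_le _ (by positivity) (by positivity)).trans ?_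
    rw [hκ', ← ENNReal.ofReal_mul (by positivity)]
    apply ENNReal.ofReal_le_ofReal
    have e : 5 * (4 * (2 : ℝ) ^ k) ^ 2 / (ρ * 2 ^ k) ^ 4 * κ
        = 80 * κ / ρ ^ 4 * ((1 / 2) ^ k * (1 / 2) ^ k) := by
      rw [div_pow, one_pow]; field_simp; ring
    rw [e]
    have : ((1 : ℝ) / 2) ^ k ≤ 1 := pow_le_one₀ (by norm_num) (by norm_num)
    gcongr
    exact mul_le_of_le_one_left (by positivity) this
  refine (ENNReal.tsum_le_tsum hk).trans ?_
  rw [← ENNReal.ofReal_tsum_of_nonneg (fun j => by positivity)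
    ((summable_geometric_of_lt_one (by norm_num) (by norm_num)).mul_left _), tsum_mul_left,
    tsum_geometric_of_lt_one (by norm_num) (by norm_num)]
  apply ENNReal.ofReal_le_ofReal
  have h4 : ρ ≤ ρ ^ 4 := le_self_pow₀ hρ1 (by norm_num)
  have hρp : 0 < ρ := by linarith
  rw [div_mul_eq_mul_div, div_le_iff₀ (by positivity)]
  nlinarith

end

/-! ### Differential inequalities -/

/-- The function `(f + c/k) e^{-k(t-a)}` is nonincreasing. The sign of `k` is free: negative `k`
gives the damped bound, uniform in time, and positive `k` the growth bound. -/
lemma add_div_le_mul_exp_of_deriv_le {f f' : ℝ → ℝ} {a b k c : ℝ} (hk : k ≠ 0)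
    (hf : ContinuousOn f (Icc a b)) (hf' : ∀ t ∈ Ioo a b, HasDerivAt f (f' t) t)
    (h : ∀ t ∈ Ioo a b, f' t ≤ k * f t + c) {t : ℝ} (ht : t ∈ Icc a b) :
    f t + c / k ≤ (f a + c / k) * Real.exp (k * (t - a)) := by
  have hd : ∀ t ∈ Ioo a b, HasDerivAt (fun t => (f t + c / k) * Real.exp (-(k * (t - a))))
      (f' t * Real.exp (-(k * (t - a))) +
        (f t + c / k) * (Real.exp (-(k * (t - a))) * -(k * 1))) t := by
    intro t ht
    exact ((hf' t ht).add_const _).mul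
      ((((hasDerivAt_id t).sub_const a).const_mul k).neg.exp)
  have hanti : AntitoneOn (fun t => (f t + c / k) * Real.exp (-(k * (t - a)))) (Icc a b) := by
    refine antitoneOn_of_deriv_nonpos (convex_Icc a b) ?_ ?_ ?_
    · exact (hf.add continuousOn_const).mul (by fun_prop)
    · rw [interior_Icc]
      exact fun t ht => (hd t ht).differentiableAt.differentiableWithinAt
    · rw [interior_Icc]
      intro t ht
      rw [(hd t ht).deriv]
      have h1 := h t ht
      have e : f' t * Real.exp (-(k * (t - a))) +
        (f t + c / k) * (Real.exp (-(k * (t - a))) * -(k * 1)) =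
        (f' t - (k * f t + c)) * Real.exp (-(k * (t - a))) := by
          field_simp
          ring
      rw [e]
      exact mul_nonpos_of_nonpos_of_nonneg (by linarith) (Real.exp_pos _).le
  have := hanti (left_mem_Icc.2 (ht.1.trans ht.2)) ht ht.1
  simp only [sub_self, mul_zero, neg_zero, Real.exp_zero, mul_one] at this
  rw [Real.exp_neg, ← div_eq_mul_inv, div_le_iff₀ (Real.exp_pos _)] at this
  exact this

lemma le_add_div_of_deriv_le {f f' : ℝ → ℝ} {a b k c : ℝ} (hk : 0 < k) (hc : 0 ≤ c)
    (hf : ContinuousOn f (Icc a b)) (hf' : ∀ t ∈ Ioo a b, HasDerivAt f (f' t) t)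
    (h : ∀ t ∈ Ioo a b, f' t ≤ -k * f t + c) (ha : 0 ≤ f a) {t : ℝ} (ht : t ∈ Icc a b) :
    f t ≤ f a + c / k := by
  have h1 := add_div_le_mul_exp_of_deriv_le (neg_ne_zero.2 hk.ne') hf hf' h ht
  have h2 : Real.exp (-k * (t - a)) ≤ 1 :=
    Real.exp_le_one_iff.2 (by nlinarith [ht.1])
  have h3 := Real.exp_pos (-k * (t - a))
  have h4 : 0 ≤ c / k := by positivity
  rw [div_neg] at h1
  nlinarith [mul_nonneg h4 h3.le]

lemma le_mul_exp_of_deriv_le {f f' : ℝ → ℝ} {a b k c : ℝ} (hk : 0 < k) (hc : 0 ≤ c)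
    (hf : ContinuousOn f (Icc a b)) (hf' : ∀ t ∈ Ioo a b, HasDerivAt f (f' t) t)
    (h : ∀ t ∈ Ioo a b, f' t ≤ k * f t + c) {t : ℝ} (ht : t ∈ Icc a b) :
    f t ≤ (f a + c / k) * Real.exp (k * (t - a)) := by
  have h1 := add_div_le_mul_exp_of_deriv_le hk.ne' hf hf' h ht
  have h4 : 0 ≤ c / k := by positivity
  linarith

/-- A barrier for a function whose derivative is negative at the level of the barrier. -/
lemma le_of_deriv_neg_at_level {f f' : ℝ → ℝ} {a b M : ℝ}
    (hf' : ∀ t ∈ Icc a b, HasDerivAt f (f' t) t) (ha : f a ≤ M)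
    (h : ∀ t ∈ Icc a b, f t = M → f' t < 0) {t : ℝ} (ht : t ∈ Icc a b) : f t ≤ M :=
  image_le_of_deriv_right_lt_deriv_boundary (B := fun _ => M) (B' := fun _ => 0)
    (fun s hs => (hf' s hs).continuousAt.continuousWithinAt)
    (fun s hs => (hf' s ⟨hs.1, hs.2.le⟩).hasDerivWithinAt) ha
    (fun s => hasDerivAt_const s M) (fun s hs => h s ⟨hs.1, hs.2.le⟩) ht

/-- Derivative of `⟨S f, f⟩` for a symmetric operator `S`, when only `f` is differentiable and
`a = S f` is continuous. -/
lemma hasDerivAt_inner_of_symm {E : Type*} [NormedAddCommGroup E] [InnerProductSpace ℝ E]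
    {f a : ℝ → E} {f' : E} {t : ℝ} (hf : HasDerivAt f f' t) (ha : ContinuousAt a t)
    (hs : ∀ᶠ s in 𝓝 t, ⟪a s, f t⟫ = ⟪f s, a t⟫) :
    HasDerivAt (fun s => ⟪a s, f s⟫) (2 * ⟪a t, f'⟫) t := by
  rw [hasDerivAt_iff_tendsto_slope] at hf ⊢
  have ha' : Tendsto a (𝓝[≠] t) (𝓝 (a t)) := ha.tendsto.mono_left nhdsWithin_le_nhds
  -- Symmetry replaces `⟨a s, f t⟩` by `⟨f s, a t⟩`, so the difference quotient of `⟨a, f⟩` contains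
  -- difference quotients of `f` only.
  have h1 : Tendsto (fun s => ⟪a s, slope f t s⟫ + ⟪slope f t s, a t⟫) (𝓝[≠] t)
      (𝓝 (⟪a t, f'⟫ + ⟪f', a t⟫)) := (ha'.inner hf).add (hf.inner tendsto_const_nhds)
  rw [real_inner_comm (a t) f', ← two_mul] at h1
  refine h1.congr' ?_
  filter_upwards [hs.filter_mono nhdsWithin_le_nhds] with s hs'
  simp only [slope_def_module, inner_smul_left, inner_smul_right, inner_sub_left, inner_sub_right,
    smul_eq_mul]
  rw [hs', real_inner_comm (a t) (f t)]
  simp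
  ring

/-! ### Integrals over the past of a path -/

lemma hasDerivAt_integral_Iic {f : ℝ → ℝ} (hf : Continuous f) (hi : IntegrableOn f (Iic 0))
    (t : ℝ) : HasDerivAt (fun t => ∫ s in Iic t, f s) (f t) t := by
  have hint : ∀ c, IntegrableOn f (Iic c) := by
    intro c
    refine (hi.union (hf.integrableOn_Icc (a := 0) (b := c))).mono_set fun x hx => ?_
    rcases le_total x 0 with h | h
    · exact Or.inl h
    · exact Or.inr ⟨h, hx⟩
  have h1 : (fun t => ∫ s in Iic t, f s) = fun t => (∫ s in (0 : ℝ)..t, f s) + ∫ s in Iic 0, f s := by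
    ext t
    have := intervalIntegral.integral_Iic_sub_Iic (hint 0) (hint t)
    linarith
  rw [h1]
  exact (intervalIntegral.integral_hasDerivAt_right (hf.intervalIntegrable _ _)
    (hf.stronglyMeasurableAtFilter _ _) hf.continuousAt).add_const _

lemma integral_Iic_zero_comp_add (f : ℝ → ℝ) (t : ℝ) :
    ∫ s in Iic 0, f (t + s) = ∫ s in Iic t, f s := by
  have h := (measurePreserving_add_left (volume : Measure ℝ) t).setIntegral_preimage_emb
    (measurableEmbedding_addLeft t) f (Iic t)
  simpa using h

/-- For the Ornstein–Uhlenbeck process `Z`, `(Z - σ W)' = - Z`. -/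
lemma hasDerivAt_ou_sub {Ω : Type*} {W : ℝ → Ω → ℝ} {ω : Ω} {σ C : ℝ}
    (hc : Continuous fun t => W t ω) (hC : ∀ s, |W s ω| ≤ C * (1 + |s|)) (t : ℝ) :
    HasDerivAt (fun t => ou W σ t ω - σ * W t ω) (-ou W σ t ω) t := by
  set f : ℝ → ℝ := fun r => Real.exp r * W r ω with hf
  have hfc : Continuous f := Real.continuous_exp.mul hc
  have hC0 : 0 ≤ C := by simpa using (abs_nonneg _).trans (hC 0)
  have hfi : IntegrableOn f (Iic 0) := by
    refine Integrable.mono' ((integrableOn_exp_mul_Iic (a := 1 / 2) (by norm_num) 0).const_mul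
      (2 * C)) hfc.aestronglyMeasurable.restrict ?_
    filter_upwards [ae_restrict_mem measurableSet_Iic] with r hr
    have hr : r ≤ 0 := hr
    have h1 : 1 + |r| ≤ 2 * Real.exp (-(1 / 2 * r)) := by
      rw [abs_of_nonpos hr]
      have := Real.add_one_le_exp (-(1 / 2 * r))
      linarith
    calc ‖f r‖ = Real.exp r * |W r ω| := by
          rw [hf, Real.norm_eq_abs, abs_mul, abs_of_pos (Real.exp_pos _)]
      _ ≤ Real.exp r * (C * (2 * Real.exp (-(1 / 2 * r)))) := by
          gcongr
          exact (hC r).trans (by gcongr)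
      _ = 2 * C * (Real.exp r * Real.exp (-(1 / 2 * r))) := by ring
      _ = _ := by rw [← Real.exp_add]; ring_nf
  have hfit : ∀ t, IntegrableOn f (Iic t) := by
    intro c
    refine (hfi.union (hfc.integrableOn_Icc (a := 0) (b := c))).mono_set fun x hx => ?_
    rcases le_total x 0 with h | h
    · exact Or.inl h
    · exact Or.inr ⟨h, hx⟩
  -- The shift `r = t + s` isolates the nondifferentiable part `σ W_t`; what remains is `e^{-t}`
  -- times an integral of a continuous function up to `t`.
  have hou : ∀ t, ou W σ t ω =
      σ * W t ω - σ * (Real.exp (-t) * ∫ s in Iic t, f s) := by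
    intro t
    unfold ou
    have hi1 : IntegrableOn (fun s => f (t + s)) (Iic 0) := by
      have := (measurePreserving_add_left (volume : Measure ℝ) t).integrableOn_comp_preimage
        (measurableEmbedding_addLeft t) (f := f) (s := Iic t)
      simp only [preimage_const_add_Iic, sub_self] at this
      exact this.2 (hfit t)
    have h1 : ∀ s, Real.exp s * (W (t + s) ω - W t ω) =
        Real.exp (-t) * f (t + s) - W t ω * Real.exp s := by
      intro s
      rw [hf]
      simp only
      rw [← mul_assoc, ← Real.exp_add]
      ring_nf
    simp_rw [h1]
    rw [integral_sub (hi1.const_mul _) ((integrableOn_exp_Iic 0).const_mul _),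
      integral_const_mul, integral_const_mul, integral_exp_Iic_zero, integral_Iic_zero_comp_add]
    ring
  have hd : HasDerivAt (fun t => -(σ * (Real.exp (-t) * ∫ s in Iic t, f s)))
      (-(σ * (Real.exp (-t) * (-1) * (∫ s in Iic t, f s) + Real.exp (-t) * f t))) t :=
    (((hasDerivAt_id t).neg.exp.mul (hasDerivAt_integral_Iic hfc hfi t)).const_mul σ).neg
  have e1 : (fun t => ou W σ t ω - σ * W t ω) =
      fun t => -(σ * (Real.exp (-t) * ∫ s in Iic t, f s)) := by
    ext t; rw [hou]; ring
  rw [e1]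
  convert hd using 1
  rw [hou, hf]
  simp only
  rw [← mul_assoc (Real.exp (-t)) (Real.exp t), ← Real.exp_add]
  simp
  ring

/-- The moving average `∫_{-∞}^0 e^{a s + g(t+s)} ds`. -/
def expAverage (a : ℝ) (g : ℝ → ℝ) (t : ℝ) : ℝ := ∫ s in Iic (0 : ℝ), Real.exp (a * s + g (t + s))

section ExpAverage

variable {g : ℝ → ℝ} {a R ε : ℝ}

lemma integrableOn_exp_add (hg : Continuous g) (hgR : ∀ s, |g s| ≤ R * (1 + ε * |s|))
    (ha : 0 < a - R * ε) : IntegrableOn (fun s => Real.exp (a * s + g s)) (Iic 0) := by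
  refine Integrable.mono' ((integrableOn_exp_mul_Iic ha 0).const_mul (Real.exp R))
    (by fun_prop) ?_
  filter_upwards [ae_restrict_mem measurableSet_Iic] with r hr
  have hr : r ≤ 0 := hr
  rw [Real.norm_eq_abs, abs_of_pos (Real.exp_pos _), ← Real.exp_add]
  have h1 := (abs_le.1 (hgR r)).2
  rw [abs_of_nonpos hr] at h1
  exact Real.exp_le_exp.2 (by linarith)

/-- After a shift the average is `e^{-at} ∫_{-∞}^t e^{ar + g(r)} dr`, which is differentiable
although `g` is merely continuous. -/
lemma hasDerivAt_expAverage (hg : Continuous g) (hgR : ∀ s, |g s| ≤ R * (1 + ε * |s|))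
    (ha : 0 < a - R * ε) (t : ℝ) :
    HasDerivAt (expAverage a g) (-a * expAverage a g t + Real.exp (g t)) t := by
  set f : ℝ → ℝ := fun s => Real.exp (a * s + g s) with hf
  have hfc : Continuous f := by fun_prop
  have he : ∀ t, expAverage a g t = Real.exp (-(a * t)) * ∫ s in Iic t, f s := by
    intro t
    rw [← integral_Iic_zero_comp_add, ← integral_const_mul]
    unfold expAverage
    congr 1; ext s
    rw [hf]; simp only; rw [← Real.exp_add]; ring_nf
  have h1 : HasDerivAt (fun t => Real.exp (-(a * t)) * ∫ s in Iic t, f s)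
      (Real.exp (-(a * t)) * (-(a * 1)) * (∫ s in Iic t, f s) + Real.exp (-(a * t)) * f t) t :=
    (((hasDerivAt_id t).const_mul a).neg.exp.mul
      (hasDerivAt_integral_Iic hfc (integrableOn_exp_add hg hgR ha) t))
  rw [show expAverage a g = fun t => Real.exp (-(a * t)) * ∫ s in Iic t, f s from funext he]
  convert h1 using 1
  rw [hf]; simp only; rw [← Real.exp_add]; ring_nf

lemma expAverage_nonneg (t : ℝ) : 0 ≤ expAverage a g t :=
  integral_nonneg fun _ => (Real.exp_pos _).le

/-- The growth of `g` over the past costs at most the rate `R ε`, which is taken out of the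
exponential weight. -/
lemma expAverage_le (hgR : ∀ s, |g s| ≤ R * (1 + ε * |s|)) (hR : 0 ≤ R) (hε : 0 ≤ ε)
    (ha : 0 < a - R * ε) {t : ℝ} :
    expAverage a g t ≤ Real.exp (R * (1 + ε * |t|)) / (a - R * ε) := by
  have h1 : ∀ s ∈ Iic (0 : ℝ), Real.exp (a * s + g (t + s)) ≤
      Real.exp (R * (1 + ε * |t|)) * Real.exp ((a - R * ε) * s) := by
    intro s hs
    have hs : s ≤ 0 := hs
    rw [← Real.exp_add]
    apply Real.exp_le_exp.2
    have h2 := (abs_le.1 (hgR (t + s))).2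
    have h3 : |t + s| ≤ |t| - s := by
      have := abs_add_le t s
      rwa [abs_of_nonpos hs] at this
    have h4 : R * (1 + ε * |t + s|) ≤ R * (1 + ε * (|t| - s)) := by gcongr
    linarith
  calc expAverage a g t ≤
      ∫ s in Iic (0 : ℝ), Real.exp (R * (1 + ε * |t|)) * Real.exp ((a - R * ε) * s) := by
        refine integral_mono_of_nonneg (Eventually.of_forall fun _ => (Real.exp_pos _).le)
          ((integrableOn_exp_mul_Iic ha 0).const_mul _) ?_
        filter_upwards [ae_restrict_mem measurableSet_Iic] with s hs using h1 s hs
    _ = _ := by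
      rw [integral_const_mul, integral_exp_mul_Iic ha]
      simp [div_eq_mul_inv]

end ExpAverage

namespace Model

/-! ### Spectral bounds, energy identities and a priori estimates along a fixed path. -/

section Core

variable {H V : Type*} [NormedAddCommGroup H] [InnerProductSpace ℝ H]
  [NormedAddCommGroup V] [NormedSpace ℝ V] (m : Model H V)

/-- `L_λ` as a linear map on `D(A)`. -/
def Lmap (lam : ℝ) : m.A.domain →ₗ[ℝ] H :=
  -m.A.toFun + (m.P lam).toLinearMap ∘ₗ m.incl

/-- `B(e_1, e_1)`. -/
def forcing (lam : ℝ) : H := m.B (m.eV lam 1) (m.eV lam 1)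

lemma Lmap_apply (lam : ℝ) (w : m.A.domain) :
    m.Lmap lam w = -m.A w + m.P lam (m.incl w) := rfl

/-- The properties of the linear part at a fixed parameter, with explicit constants. -/
structure SpectralBounds (lam : ℝ) (N : ℕ+) (c C η δ κ : ℝ) : Prop where
  emb_incl : ∀ u : m.A.domain, m.emb (m.incl u) = (u : H)
  symmA : ∀ w z : m.A.domain, ⟪m.A w, (z : H)⟫ = ⟪(w : H), m.A z⟫
  symmL : ∀ w z : m.A.domain, ⟪m.Lmap lam w, (z : H)⟫ = ⟪(w : H), m.Lmap lam z⟫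
  c_pos : 0 < c
  C_pos : 0 < C
  η_lt : η < 1
  δ_pos : 0 < δ
  κ_nonneg : 0 ≤ κ
  β_pos : 0 < m.β lam 1
  lower : ∀ w : m.A.domain, c * ‖m.incl w‖ ^ 2 ≤ ⟪m.A w, (w : H)⟫
  upper : ∀ w : m.A.domain, ⟪m.A w, (w : H)⟫ ≤ C * ‖m.incl w‖ ^ 2
  orthonormal : Orthonormal ℝ fun n : ℕ+ => (m.e lam n : H)
  eigen : ∀ n : ℕ+, m.Lmap lam (m.e lam n) = m.β lam n • (m.e lam n : H)
  damping : ∀ w : m.A.domain, ⟪(w : H), (m.e lam 1 : H)⟫ = 0 →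
    ⟪-(η • m.A w) + m.P lam (m.incl w), (w : H)⟫ ≤ -δ * ‖(w : H)‖ ^ 2 ∧
      ⟪-(η • m.A w) + m.P lam (m.incl w), m.A w⟫ ≤ -δ * ⟪m.A w, (w : H)⟫
  energy : ∀ u : V, ⟪m.B u u, m.emb u⟫ = 0
  forcing_eq : m.forcing lam = ∑ n ∈ Finset.Icc 2 N, m.coeff lam 1 1 n • (m.e lam n : H)
  eV_le : ‖m.eV lam 1‖ ≤ κ

variable {m} {lam : ℝ} {N : ℕ+} {c C η δ κ : ℝ}

/-- Polarisation: subtracting the identities at `u + v` and `u - v` leaves the part linear in `v`,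
together with the vanishing cubic term in `v`. -/
lemma inner_trilinear_eq_zero (henergy : ∀ u : V, ⟪m.B u u, m.emb u⟫ = 0) (u v : V) :
    ⟪m.B u v + m.B v u, m.emb u⟫ + ⟪m.B u u, m.emb v⟫ = 0 := by
  have h1 := henergy (u + v)
  have h2 := henergy (u - v)
  have h3 := henergy v
  have h4 := henergy u
  simp only [map_add, map_sub, _root_.add_apply, _root_.sub_apply,
    inner_add_left, inner_add_right, inner_sub_left, inner_sub_right] at h1 h2 ⊢
  linarith

namespace SpectralBounds

variable (hs : m.SpectralBounds lam N c C η δ κ)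
include hs

lemma emb_eV (n : ℕ+) : m.emb (m.eV lam n) = (m.e lam n : H) := hs.emb_incl _

lemma inner_self_e (n : ℕ+) : ⟪(m.e lam n : H), (m.e lam n : H)⟫ = 1 := by
  rw [real_inner_self_eq_norm_sq, hs.orthonormal.1 n]; norm_num

lemma norm_e (n : ℕ+) : ‖(m.e lam n : H)‖ = 1 := hs.orthonormal.1 n

/-- The feedback of the stable modes on the critical one is minus the pairing with the very vector
that excites them. This is the source of the dissipative sign in the reduced equation. -/
lemma Fc_eq (v : V) : m.Fc lam v = -⟪m.forcing lam, m.emb v⟫ := by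
  have := inner_trilinear_eq_zero hs.energy (m.eV lam 1) v
  rw [hs.emb_eV] at this
  unfold Fc forcing
  linarith

lemma inner_forcing_e : ⟪m.forcing lam, (m.e lam 1 : H)⟫ = 0 := by
  rw [← hs.emb_eV]; exact hs.energy _

lemma norm_forcing_le : ‖m.forcing lam‖ ≤ ‖m.B‖ * κ ^ 2 := by
  have hκ := hs.κ_nonneg
  refine (m.B.le_opNorm₂ _ _).trans ?_
  have := hs.eV_le
  calc ‖m.B‖ * ‖m.eV lam 1‖ * ‖m.eV lam 1‖ ≤ ‖m.B‖ * κ * κ := by gcongr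
    _ = _ := by ring

lemma A_nonneg (w : m.A.domain) : 0 ≤ ⟪m.A w, (w : H)⟫ :=
  (mul_nonneg hs.c_pos.le (sq_nonneg _)).trans (hs.lower w)

lemma inner_Lmap_le {w : m.A.domain} (hw : ⟪(w : H), (m.e lam 1 : H)⟫ = 0) :
    ⟪m.Lmap lam w, (w : H)⟫ ≤ -δ * ‖(w : H)‖ ^ 2 := by
  have h1 := (hs.damping w hw).1
  have h2 := hs.A_nonneg w
  have h3 := hs.η_lt
  rw [Lmap_apply]
  simp only [inner_add_left, inner_neg_left, inner_smul_left, RCLike.conj_to_real] at h1 ⊢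
  nlinarith

/-- Only the fraction `η` of `A` is spent on controlling `P_λ`. The unused `(1 - η) ‖A w‖²` later
absorbs the nonlinearity, which is controlled in `H` only. -/
lemma inner_Lmap_A_le {w : m.A.domain} (hw : ⟪(w : H), (m.e lam 1 : H)⟫ = 0) :
    ⟪m.Lmap lam w, m.A w⟫ ≤ -(1 - η) * ‖m.A w‖ ^ 2 - δ * ⟪m.A w, (w : H)⟫ := by
  have h1 := (hs.damping w hw).2
  rw [Lmap_apply]
  simp only [inner_add_left, inner_neg_left, inner_smul_left, RCLike.conj_to_real,
    real_inner_self_eq_norm_sq] at h1 ⊢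
  linarith

lemma inner_Lmap_e (w : m.A.domain) :
    ⟪m.Lmap lam w, (m.e lam 1 : H)⟫ = m.β lam 1 * ⟪(w : H), (m.e lam 1 : H)⟫ := by
  rw [hs.symmL, hs.eigen, inner_smul_right]

end SpectralBounds

/-- The high-mode part of an element of `D(A)`. -/
def highD (m : Model H V) (lam : ℝ) (w : m.A.domain) : m.A.domain :=
  w - ⟪(w : H), (m.e lam 1 : H)⟫ • m.e lam 1

/-- The orthogonal projection on the complement of `e_1`. -/
def proj (m : Model H V) (lam : ℝ) (h : H) : H :=
  h - ⟪h, (m.e lam 1 : H)⟫ • (m.e lam 1 : H)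

lemma coe_highD (w : m.A.domain) : (m.highD lam w : H) = m.proj lam w := rfl

lemma inner_proj {h r : H} (hr : ⟪r, (m.e lam 1 : H)⟫ = 0) : ⟪m.proj lam h, r⟫ = ⟪h, r⟫ := by
  rw [proj, inner_sub_left, inner_smul_left, real_inner_comm r (m.e lam 1 : H), hr]; simp

namespace SpectralBounds

variable (hs : m.SpectralBounds lam N c C η δ κ)
include hs

lemma low_incl (w : m.A.domain) : m.low lam (m.incl w) = ⟪(w : H), (m.e lam 1 : H)⟫ := by
  rw [low, hs.emb_incl]

lemma incl_highD (w : m.A.domain) : m.incl (m.highD lam w) = m.high lam (m.incl w) := by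
  rw [highD, high, hs.low_incl, map_sub, map_smul]; rfl

lemma emb_high (u : V) : m.emb (m.high lam u) = m.proj lam (m.emb u) := by
  rw [high, proj, map_sub, map_smul, hs.emb_eV]; rfl

lemma inner_proj_e (h : H) : ⟪m.proj lam h, (m.e lam 1 : H)⟫ = 0 := by
  rw [proj, inner_sub_left, inner_smul_left, hs.inner_self_e]; simp

lemma norm_sq_eq (h : H) : ‖h‖ ^ 2 = ⟪h, (m.e lam 1 : H)⟫ ^ 2 + ‖m.proj lam h‖ ^ 2 := by
  rw [← real_inner_self_eq_norm_sq, ← real_inner_self_eq_norm_sq]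
  simp only [proj, inner_sub_left, inner_sub_right, inner_smul_left, inner_smul_right,
    hs.inner_self_e, RCLike.conj_to_real]
  rw [real_inner_comm h (m.e lam 1 : H)]
  ring

lemma norm_proj_le (h : H) : ‖m.proj lam h‖ ≤ ‖h‖ := by
  have := hs.norm_sq_eq h
  refine le_of_sq_le_sq ?_ (norm_nonneg _)
  nlinarith [sq_nonneg ⟪h, (m.e lam 1 : H)⟫]

lemma Lmap_highD (w : m.A.domain) : m.Lmap lam (m.highD lam w) = m.proj lam (m.Lmap lam w) := by
  rw [highD, proj, map_sub, map_smul, hs.eigen, hs.inner_Lmap_e, smul_smul, mul_comm]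

lemma inner_highD_e (w : m.A.domain) : ⟪(m.highD lam w : H), (m.e lam 1 : H)⟫ = 0 :=
  hs.inner_proj_e _

/-- The critical mode carries the largest eigenvalue. -/
lemma inner_Lmap_self_le (w : m.A.domain) :
    ⟪m.Lmap lam w, (w : H)⟫ ≤ m.β lam 1 * ‖(w : H)‖ ^ 2 := by
  have h1 := hs.inner_Lmap_le (hs.inner_highD_e w)
  rw [hs.Lmap_highD, inner_proj (hs.inner_highD_e w), coe_highD] at h1
  have h2 := hs.norm_sq_eq (w : H)
  have h3 : ⟪m.Lmap lam w, (w : H)⟫ = ⟪m.Lmap lam w, m.proj lam w⟫ +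
      m.β lam 1 * ⟪(w : H), (m.e lam 1 : H)⟫ ^ 2 := by
    rw [proj, inner_sub_right, inner_smul_right, hs.inner_Lmap_e]; ring
  have h4 := hs.β_pos
  have h5 := hs.δ_pos
  rw [h3, h2]
  nlinarith [sq_nonneg ‖m.proj lam (w : H)‖, mul_nonneg h4.le (sq_nonneg ‖m.proj lam (w : H)‖),
    mul_nonneg h5.le (sq_nonneg ‖m.proj lam (w : H)‖)]

lemma c_le_C : c ≤ C := by
  have h1 := (hs.lower (m.e lam 1)).trans (hs.upper (m.e lam 1))
  refine le_of_mul_le_mul_right h1 (pow_pos (norm_pos_iff.2 fun h0 => ?_) 2)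
  have h2 := hs.norm_e 1
  rw [← hs.emb_incl, h0] at h2
  simp at h2

lemma norm_low_le (u : V) : |m.low lam u| ≤ ‖m.emb u‖ := by
  have := abs_real_inner_le_norm (m.emb u) (m.e lam 1 : H)
  rwa [hs.norm_e, mul_one] at this

lemma norm_le (u : V) : ‖u‖ ≤ |m.low lam u| * κ + ‖m.high lam u‖ := by
  have h : u = m.low lam u • m.eV lam 1 + m.high lam u := by rw [high]; abel
  calc ‖u‖ = ‖m.low lam u • m.eV lam 1 + m.high lam u‖ := by rw [← h]
    _ ≤ ‖m.low lam u • m.eV lam 1‖ + ‖m.high lam u‖ := norm_add_le _ _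
    _ ≤ _ := by
      rw [norm_smul, Real.norm_eq_abs]
      gcongr
      exact hs.eV_le

end SpectralBounds

/-- A classical solution, along a fixed path `g` of the noise, of `w' = L_λ w + e^g B(w, w)`,
on a set `J` of times. -/
structure IsPathSolution (m : Model H V) (lam : ℝ) (g : ℝ → ℝ) (J : Set ℝ) (w : ℝ → V)
    (D : ℝ → m.A.domain) : Prop where
  mem : ∀ t ∈ J, Icc 0 t ⊆ J
  isOpen : IsOpen (J ∩ Ioi 0)
  cont : ContinuousOn w J
  incl : ∀ t ∈ J ∩ Ioi 0, m.incl (D t) = w t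
  contA : ContinuousOn (fun t => m.A (D t)) (J ∩ Ioi 0)
  deriv : ∀ t ∈ J ∩ Ioi 0, HasDerivAt (fun s => m.emb (w s))
    (m.Lmap lam (D t) + Real.exp (g t) • m.B (w t) (w t)) t

namespace IsPathSolution

variable {g : ℝ → ℝ} {J : Set ℝ} {w : ℝ → V} {D : ℝ → m.A.domain}

/-- The energy estimate. -/
lemma norm_sq_le (hw : m.IsPathSolution lam g J w D) (hs : m.SpectralBounds lam N c C η δ κ)
    {t : ℝ} (ht : t ∈ J) (ht0 : 0 ≤ t) :
    ‖m.emb (w t)‖ ^ 2 ≤ ‖m.emb (w 0)‖ ^ 2 * Real.exp (2 * m.β lam 1 * t) := by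
  have hε := hs.β_pos
  have hsub := hw.mem t ht
  have h := le_mul_exp_of_deriv_le (a := 0) (b := t) (k := 2 * m.β lam 1) (c := 0)
    (f := fun t => ‖m.emb (w t)‖ ^ 2)
    (f' := fun t => 2 * ⟪m.emb (w t), m.Lmap lam (D t) + Real.exp (g t) • m.B (w t) (w t)⟫)
    (by positivity) le_rfl
    (((m.emb.continuous.comp_continuousOn (hw.cont.mono hsub)).norm).pow 2)
    (fun s hs' => (hw.deriv s ⟨hsub ⟨hs'.1.le, hs'.2.le⟩, hs'.1⟩).norm_sq)
    (fun s hs' => ?_) (right_mem_Icc.2 ht0)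
  · simpa using h
  · have hsJ : s ∈ J ∩ Ioi 0 := ⟨hsub ⟨hs'.1.le, hs'.2.le⟩, hs'.1⟩
    have h1 := hs.inner_Lmap_self_le (D s)
    have h2 := hs.energy (w s)
    have h3 : m.emb (w s) = (D s : H) := by rw [← hw.incl s hsJ, hs.emb_incl]
    rw [inner_add_right, inner_smul_right, real_inner_comm, real_inner_comm (m.B (w s) (w s)), h2,
      h3]
    linarith

lemma hasDerivAt_low (hw : m.IsPathSolution lam g J w D)
    (hs : m.SpectralBounds lam N c C η δ κ) {t : ℝ} (ht : t ∈ J ∩ Ioi 0) :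
    HasDerivAt (fun s => m.low lam (w s))
      (m.β lam 1 * m.low lam (w t) +
        Real.exp (g t) * ⟪m.B (w t) (w t), (m.e lam 1 : H)⟫) t := by
  have h := (hw.deriv t ht).inner ℝ (hasDerivAt_const t (m.e lam 1 : H))
  simp only [inner_zero_right, zero_add] at h
  rw [inner_add_left, hs.inner_Lmap_e, inner_smul_left, ← hs.low_incl, hw.incl t ht] at h
  exact h

lemma hasDerivAt_high (hw : m.IsPathSolution lam g J w D)
    (hs : m.SpectralBounds lam N c C η δ κ) {t : ℝ} (ht : t ∈ J ∩ Ioi 0) :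
    HasDerivAt (fun s => m.emb (m.high lam (w s)))
      (m.Lmap lam (m.highD lam (D t)) + Real.exp (g t) • m.proj lam (m.B (w t) (w t))) t := by
  have h := (hw.deriv t ht).sub ((hw.hasDerivAt_low hs ht).smul_const (m.e lam 1 : H))
  have e : (fun s => m.emb (m.high lam (w s))) =
      fun s => m.emb (w s) - m.low lam (w s) • (m.e lam 1 : H) := by
    ext s; rw [hs.emb_high]; rfl
  rw [e]
  convert! h using 1
  rw [hs.Lmap_highD, proj, proj, hs.inner_Lmap_e, ← hs.low_incl, hw.incl t ht]
  module

/-- The `V`-estimate of the stable modes, by a barrier for the energy `⟨A w, w⟩`. -/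
lemma norm_high_sq_le (hw : m.IsPathSolution lam g J w D)
    (hs : m.SpectralBounds lam N c C η δ κ) {b s G C₁ K₀ Λ : ℝ}
    (hs0 : 0 < s) (hC₁ : 0 ≤ C₁) (hK₀ : 0 ≤ K₀) (hG : 0 ≤ G)
    (hg : ∀ t ∈ Icc 0 b, Real.exp (g t) ≤ G)
    (hlow : ∀ t ∈ J ∩ Icc 0 b, |m.low lam (w t)| ≤ C₁ * s)
    (hinit : ‖m.high lam (w 0)‖ ≤ K₀ * s ^ 2)
    (hΛ : C * (K₀ + 1) ^ 2 ≤ Λ)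
    (hΛ' : (G * (‖m.B‖ * (C₁ * κ + 1) ^ 2)) ^ 2 < 4 * (1 - η) * δ * Λ)
    (hsmall : Λ * s ^ 2 ≤ c) {t : ℝ} (ht : t ∈ J ∩ Icc 0 b) :
    c * ‖m.high lam (w t)‖ ^ 2 ≤ Λ * s ^ 4 := by
  have hc := hs.c_pos
  have hC := hs.C_pos
  have hη := hs.η_lt
  have hκ := hs.κ_nonneg
  have hhigh : ContinuousOn (fun t => m.high lam (w t)) J := by
    have hl : ContinuousOn (fun t => m.low lam (w t)) J :=
      (m.emb.continuous.comp_continuousOn hw.cont).inner continuousOn_const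
    exact hw.cont.sub (hl.smul continuousOn_const)
  -- The solution lies in `D(A)` for positive times only, so the barrier argument starts at a small
  -- `t₀ > 0`. Continuity in `V` at `0` supplies the bound there, the `+ 1` being the slack.
  have hclose : ∀ t ∈ J ∩ Ioi 0, ∃ t₀ ∈ Ioc 0 t, ‖m.high lam (w t₀)‖ < (K₀ + 1) * s ^ 2 := by
    intro t ht
    have h0 : ContinuousWithinAt (fun t => ‖m.high lam (w t)‖) (Ioc 0 t) 0 :=
      ((hhigh 0 (hw.mem t ht.1 (left_mem_Icc.2 ht.2.le))).norm).mono
        (Ioc_subset_Icc_self.trans (hw.mem t ht.1))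
    have h1 : ∀ᶠ r in 𝓝[Ioc 0 t] (0 : ℝ), ‖m.high lam (w r)‖ < (K₀ + 1) * s ^ 2 :=
      h0.tendsto.eventually (gt_mem_nhds (by nlinarith [sq_pos_of_pos hs0]))
    rw [nhdsWithin_Ioc_eq_nhdsGT ht.2] at h1
    have h2 : ∀ᶠ r in 𝓝[>] (0 : ℝ), r ∈ Ioc 0 t := Ioc_mem_nhdsGT ht.2
    obtain ⟨t₀, h3, h4⟩ := (h2.and h1).exists
    exact ⟨t₀, h3, h4⟩
  rcases eq_or_lt_of_le ht.2.1 with h0 | hpos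
  · rw [← h0]
    calc c * ‖m.high lam (w 0)‖ ^ 2 ≤ C * (K₀ * s ^ 2) ^ 2 := by
          gcongr
          exact hs.c_le_C
      _ = C * K₀ ^ 2 * s ^ 4 := by ring
      _ ≤ C * (K₀ + 1) ^ 2 * s ^ 4 := by gcongr; linarith
      _ ≤ Λ * s ^ 4 := by gcongr
  have htJ : t ∈ J ∩ Ioi 0 := ⟨ht.1, hpos⟩
  obtain ⟨t₀, ht₀, hlt⟩ := hclose t htJ
  set a : ℝ → H := fun r => m.A (m.highD lam (D r)) with ha
  have hmemJ : ∀ r ∈ Icc t₀ t, r ∈ J ∩ Ioi 0 := fun r hr =>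
    ⟨hw.mem t ht.1 ⟨ht₀.1.le.trans hr.1, hr.2⟩, ht₀.1.trans_le hr.1⟩
  have hlowD : ∀ r ∈ J ∩ Ioi 0, m.low lam (w r) = ⟪(D r : H), (m.e lam 1 : H)⟫ := fun r hr => by
    rw [← hw.incl r hr, hs.low_incl]
  have hhighD : ∀ r ∈ J ∩ Ioi 0, m.incl (m.highD lam (D r)) = m.high lam (w r) := fun r hr => by
    rw [hs.incl_highD, hw.incl r hr]
  have hembD : ∀ r ∈ J ∩ Ioi 0, m.emb (m.high lam (w r)) = (m.highD lam (D r) : H) := fun r hr => by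
    rw [← hhighD r hr, hs.emb_incl]
  have hacont : ContinuousOn a (J ∩ Ioi 0) := by
    have hl : ContinuousOn (fun t => m.low lam (w t)) (J ∩ Ioi 0) :=
      (m.emb.continuous.comp_continuousOn (hw.cont.mono inter_subset_left)).inner continuousOn_const
    have h1 := hw.contA.sub (hl.smul (continuousOn_const (c := m.A (m.e lam 1))))
    refine h1.congr fun r hr => ?_
    simp only [ha, highD]
    rw [LinearPMap.map_sub, LinearPMap.map_smul, ← hlowD r hr]
    rfl
  have hder : ∀ r ∈ Icc t₀ t, HasDerivAt (fun r => ⟪a r, m.emb (m.high lam (w r))⟫)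
      (2 * ⟪a r, m.Lmap lam (m.highD lam (D r)) +
        Real.exp (g r) • m.proj lam (m.B (w r) (w r))⟫) r := by
    intro r hr
    have hnhds : J ∩ Ioi 0 ∈ 𝓝 r := hw.isOpen.mem_nhds (hmemJ r hr)
    refine hasDerivAt_inner_of_symm (hw.hasDerivAt_high hs (hmemJ r hr))
      (hacont.continuousAt hnhds) ?_
    filter_upwards [hnhds] with s' hs'
    rw [hembD s' hs', hembD r (hmemJ r hr), ha]
    exact hs.symmA _ _
  have hq : ∀ r ∈ J ∩ Ioi 0, c * ‖m.high lam (w r)‖ ^ 2 ≤ ⟪a r, m.emb (m.high lam (w r))⟫ ∧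
      ⟪a r, m.emb (m.high lam (w r))⟫ ≤ C * ‖m.high lam (w r)‖ ^ 2 := by
    intro r hr
    rw [hembD r hr, ← hhighD r hr]
    exact ⟨hs.lower _, hs.upper _⟩
  refine (hq t htJ).1.trans (le_of_deriv_neg_at_level (M := Λ * s ^ 4) hder ?_ ?_
    (right_mem_Icc.2 ht₀.2))
  · refine (hq t₀ (hmemJ t₀ (left_mem_Icc.2 ht₀.2))).2.trans ?_
    calc C * ‖m.high lam (w t₀)‖ ^ 2 ≤ C * ((K₀ + 1) * s ^ 2) ^ 2 := by gcongr
      _ = C * (K₀ + 1) ^ 2 * s ^ 4 := by ring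
      _ ≤ _ := by gcongr
  · intro r hr hlevel
    have hrJ := hmemJ r hr
    have hrb : r ∈ Icc 0 b := ⟨hrJ.2.le, hr.2.trans ht.2.2⟩
    -- At the barrier level the smallness condition gives the crude bound `s`. The resulting bound
    -- on `B(w, w)` does not involve `Λ`, so choosing `Λ` large afterwards is not circular.
    have h1 : ‖m.high lam (w r)‖ ≤ s := by
      have := (hq r hrJ).1
      rw [hlevel] at this
      have h2 : c * ‖m.high lam (w r)‖ ^ 2 ≤ c * s ^ 2 := by
        refine this.trans ?_
        calc Λ * s ^ 4 = Λ * s ^ 2 * s ^ 2 := by ring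
          _ ≤ _ := by gcongr
      exact le_of_sq_le_sq (le_of_mul_le_mul_left h2 hc) hs0.le
    have h2 : ‖w r‖ ≤ (C₁ * κ + 1) * s := by
      refine (hs.norm_le _).trans ?_
      have := hlow r ⟨hrJ.1, hrb⟩
      calc |m.low lam (w r)| * κ + ‖m.high lam (w r)‖ ≤ C₁ * s * κ + s := by gcongr
        _ = _ := by ring
    have h3 : ‖Real.exp (g r) • m.proj lam (m.B (w r) (w r))‖ ≤
        G * (‖m.B‖ * (C₁ * κ + 1) ^ 2) * s ^ 2 := by
      rw [norm_smul, Real.norm_eq_abs, abs_of_pos (Real.exp_pos _)]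
      have h5 : ‖m.B (w r) (w r)‖ ≤ ‖m.B‖ * ((C₁ * κ + 1) * s) * ((C₁ * κ + 1) * s) :=
        (m.B.le_opNorm₂ _ _).trans (by gcongr)
      calc _ ≤ G * (‖m.B‖ * ((C₁ * κ + 1) * s) * ((C₁ * κ + 1) * s)) := by
            gcongr
            · exact hg r hrb
            · exact (hs.norm_proj_le _).trans h5
        _ = _ := by ring
    set M := G * (‖m.B‖ * (C₁ * κ + 1) ^ 2) with hM
    have h4 := hs.inner_Lmap_A_le (hs.inner_highD_e (D r))
    rw [← hembD r hrJ] at h4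
    have h5 := real_inner_le_norm (a r) (Real.exp (g r) • m.proj lam (m.B (w r) (w r)))
    have h6 : ‖a r‖ * ‖Real.exp (g r) • m.proj lam (m.B (w r) (w r))‖ ≤ ‖a r‖ * (M * s ^ 2) := by
      gcongr
    rw [inner_add_right, real_inner_comm _ (a r)]
    change ⟪a r, _⟫ = _ at hlevel
    change ⟪_, a r⟫ ≤ -(1 - η) * ‖a r‖ ^ 2 - δ * ⟪a r, _⟫ at h4
    rw [hlevel] at h4
    -- Young's inequality absorbs the nonlinear term into `(1 - η) ‖A w_s‖²`; the remainder `M² s⁴ /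
    -- (4 (1 - η))` is strictly below the damping `δ Λ s⁴` by the choice of `Λ`.
    have h7 : 4 * (1 - η) * (‖a r‖ * (M * s ^ 2)) ≤
        4 * (1 - η) ^ 2 * ‖a r‖ ^ 2 + M ^ 2 * s ^ 4 := by
      nlinarith [sq_nonneg (2 * (1 - η) * ‖a r‖ - M * s ^ 2)]
    have h8 : M ^ 2 * s ^ 4 < 4 * (1 - η) * δ * Λ * s ^ 4 := by gcongr
    have h9 : 0 < 1 - η := by linarith
    have h10 : (1 - η) * (-(1 - η) * ‖a r‖ ^ 2 - δ * (Λ * s ^ 4) + ‖a r‖ * (M * s ^ 2)) < 0 := by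
      linarith
    have h11 := neg_of_mul_neg_right h10 h9.le
    linarith

end IsPathSolution

end Core

end Model

/-! ### Coupled slow and fast differential inequalities. -/

lemma young_mul {k δ : ℝ} (hδ : 0 < δ) (x y : ℝ) :
    2 * k * x * y ≤ δ / 2 * x ^ 2 + 2 * (k ^ 2 / δ) * y ^ 2 := by
  have h : δ / 2 * x ^ 2 + 2 * (k ^ 2 / δ) * y ^ 2 - 2 * k * x * y
      = (δ * x - 2 * k * y) ^ 2 / (2 * δ) := by
    field_simp
    ring
  have : 0 ≤ (δ * x - 2 * k * y) ^ 2 / (2 * δ) := by positivity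
  linarith

/-- Coupled differential inequalities for an error `z` in the slow variable and an error `ρ` in the
fast variable, on a time interval of length `O(s⁻²)`. -/
lemma slow_fast_estimate {z z' ρ R' : ℝ → ℝ} {b s δ k K₀ T : ℝ} (hδ : 0 < δ) (hs : 0 < s)
    (hs1 : s ≤ 1) (hk : 0 ≤ k) (hbT : s ^ 2 * b ≤ T)
    (hz : ContinuousOn z (Icc 0 b)) (hρ : ContinuousOn ρ (Icc 0 b))
    (hz' : ∀ t ∈ Ioo 0 b, HasDerivAt z (z' t) t)
    (hρ' : ∀ t ∈ Ioo 0 b, HasDerivAt (fun t => ρ t ^ 2) (R' t) t)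
    (h1 : ∀ t ∈ Ioo 0 b, z t * z' t ≤ s ^ 2 * z t ^ 2 + k * s * ρ t * |z t| + k * s ^ 4 * |z t|)
    (h2 : ∀ t ∈ Ioo 0 b, R' t ≤ 2 * (-δ * ρ t ^ 2 + k * s * |z t| * ρ t + k * s ^ 3 * ρ t))
    (hz0 : z 0 = 0) (hρ0 : ρ 0 ^ 2 ≤ (K₀ * s ^ 3) ^ 2) {t : ℝ} (ht : t ∈ Icc 0 b) :
    z t ^ 2 ≤ (K₀ ^ 2 + 1) * Real.exp ((2 + k + 4 * (k ^ 2 / δ)) * T) * s ^ 4 ∧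
    ρ t ^ 2 ≤ (K₀ ^ 2 + 2 * (k ^ 2 / δ) *
      ((K₀ ^ 2 + 1) * Real.exp ((2 + k + 4 * (k ^ 2 / δ)) * T) + 1) / δ) * s ^ 6 := by
  set L := k ^ 2 / δ with hL
  have hL0 : 0 ≤ L := by positivity
  set K := 2 + k + 4 * L with hK
  have hK0 : 0 < K := by positivity
  have hs64 : s ^ 6 ≤ s ^ 4 := pow_le_pow_of_le_one hs.le hs1 (by norm_num)
  have hR : ∀ t ∈ Ioo 0 b, R' t ≤ -δ * ρ t ^ 2 + 2 * L * s ^ 2 * z t ^ 2 + 2 * L * s ^ 6 := by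
    intro t ht
    have y1 := young_mul (k := k) hδ (ρ t) (s * |z t|)
    have y2 := young_mul (k := k) hδ (ρ t) (s ^ 3)
    rw [mul_pow, sq_abs] at y1
    have := h2 t ht
    rw [← hL] at y1 y2
    linarith
  -- First pass: the damping of `ρ` absorbs the coupling, so `z² + ρ²` grows at a rate proportional
  -- to `s²`, which over a time `T/s²` is a bounded factor. This gives order `s⁴` for both squares,
  -- the final order for `z`.
  have hE : ∀ t ∈ Icc 0 b, z t ^ 2 + ρ t ^ 2 ≤
      (K₀ ^ 2 + 1) * Real.exp (K * T) * s ^ 4 := by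
    intro t ht
    have h := le_mul_exp_of_deriv_le (a := 0) (b := b) (k := K * s ^ 2) (c := K * s ^ 6)
      (f := fun t => z t ^ 2 + ρ t ^ 2) (f' := fun t => 2 * (z t * z' t) + R' t)
      (by positivity) (by positivity) ((hz.pow 2).add (hρ.pow 2)) ?_ ?_ ht
    · refine h.trans ?_
      have e1 : K * s ^ 6 / (K * s ^ 2) = s ^ 4 := by field_simp
      rw [e1, hz0, sub_zero]
      have e2 : Real.exp (K * s ^ 2 * t) ≤ Real.exp (K * T) := by
        apply Real.exp_le_exp.2
        rw [mul_assoc]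
        gcongr
        exact (mul_le_mul_of_nonneg_left ht.2 (sq_nonneg s)).trans hbT
      calc (0 ^ 2 + ρ 0 ^ 2 + s ^ 4) * Real.exp (K * s ^ 2 * t)
          ≤ ((K₀ * s ^ 3) ^ 2 + s ^ 4) * Real.exp (K * T) := by
            gcongr
            linarith
        _ = (K₀ ^ 2 * s ^ 6 + s ^ 4) * Real.exp (K * T) := by ring
        _ ≤ (K₀ ^ 2 * s ^ 4 + s ^ 4) * Real.exp (K * T) := by gcongr
        _ = _ := by ring
    · intro t ht
      have := ((hz' t ht).pow 2).add (hρ' t ht)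
      convert! this using 1
      push_cast
      ring
    · intro t ht
      have h3 := h1 t ht
      have h4 := hR t ht
      have y1 := young_mul (k := k) hδ (ρ t) (s * |z t|)
      rw [mul_pow, sq_abs, ← hL] at y1
      have y2 : 2 * k * s ^ 4 * |z t| ≤ k * (s ^ 2 * z t ^ 2 + s ^ 6) := by
        have : 0 ≤ k * (s ^ 2 * (|z t| - s ^ 2) ^ 2) := by positivity
        have e : |z t| ^ 2 = z t ^ 2 := sq_abs _
        have e2 : k * (s ^ 2 * (|z t| - s ^ 2) ^ 2) =
            k * (s ^ 2 * |z t| ^ 2 + s ^ 6) - 2 * k * s ^ 4 * |z t| := by ring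
        rw [e] at e2
        linarith
      have h5 : 0 ≤ K * s ^ 2 * ρ t ^ 2 := by positivity
      have h6 : 0 ≤ δ * ρ t ^ 2 := by positivity
      have h7 : 0 ≤ s ^ 6 := by positivity
      have h8 : 0 ≤ L * s ^ 6 := by positivity
      have h9 : 0 ≤ s ^ 2 * z t ^ 2 := by positivity
      have e : K * s ^ 2 * (z t ^ 2 + ρ t ^ 2) + K * s ^ 6 =
        2 * (s ^ 2 * z t ^ 2) + k * (s ^ 2 * z t ^ 2) + 4 * L * (s ^ 2 * z t ^ 2)
          + K * s ^ 2 * ρ t ^ 2 + 2 * s ^ 6 + k * s ^ 6 + 4 * (L * s ^ 6) := by rw [hK]; ring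
      rw [e]
      linarith
  set A := (K₀ ^ 2 + 1) * Real.exp (K * T) with hA
  have hA0 : 0 ≤ A := by positivity
  have hzA : ∀ t ∈ Icc 0 b, z t ^ 2 ≤ A * s ^ 4 := fun t ht => by
    have := hE t ht
    nlinarith [sq_nonneg (ρ t)]
  refine ⟨hzA t ht, ?_⟩
  -- Second pass: with `z² = O(s⁴)` inserted, the forcing of `ρ²` is `O(s⁶)`, and the damping at
  -- rate `δ` makes the bound independent of the length of the interval.
  have h := le_add_div_of_deriv_le (a := 0) (b := b) (k := δ) (c := 2 * L * (A + 1) * s ^ 6)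
    (f := fun t => ρ t ^ 2) hδ (by positivity) (hρ.pow 2) hρ' ?_ (sq_nonneg _) ht
  · refine h.trans ?_
    calc ρ 0 ^ 2 + 2 * L * (A + 1) * s ^ 6 / δ ≤ (K₀ * s ^ 3) ^ 2 + 2 * L * (A + 1) * s ^ 6 / δ := by
          gcongr
      _ = _ := by ring
  · intro t ht
    have h3 := hR t ht
    have h4 := hzA t ⟨ht.1.le, ht.2.le⟩
    have h5 : 2 * L * s ^ 2 * z t ^ 2 ≤ 2 * L * s ^ 2 * (A * s ^ 4) := by gcongr
    nlinarith

/-! ### Comparison of the full and the reduced equation. -/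

namespace Model

section Comparison

variable {H V : Type*} [NormedAddCommGroup H] [InnerProductSpace ℝ H]
  [NormedAddCommGroup V] [NormedSpace ℝ V]

/-- The combination `∑_{n=2}^N B_{11}^n a_n e_n` of the stable modes. -/
def profile (m : Model H V) (lam : ℝ) (N : ℕ+) (a : ℕ+ → ℝ → ℝ) (t : ℝ) : m.A.domain :=
  ∑ n ∈ Finset.Icc 2 N, (m.coeff lam 1 1 n * a n t) • m.e lam n

variable {m : Model H V} {lam : ℝ} {N : ℕ+} {c C η δ κ : ℝ} {g : ℝ → ℝ} {a : ℕ+ → ℝ → ℝ}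

lemma coe_profile (t : ℝ) : (m.profile lam N a t : H) =
    ∑ n ∈ Finset.Icc 2 N, (m.coeff lam 1 1 n * a n t) • (m.e lam n : H) := by
  rw [profile]
  simp

/-- The pairing equals `∑ (B_{11}^n)² a_n`. -/
lemma inner_forcing_profile_nonneg {t : ℝ} (ha : ∀ n ∈ Finset.Icc 2 N, 0 ≤ a n t) :
    0 ≤ ⟪m.forcing lam, (m.profile lam N a t : H)⟫ := by
  rw [coe_profile, inner_sum]
  refine Finset.sum_nonneg fun n hn => ?_
  rw [inner_smul_right]
  change 0 ≤ m.coeff lam 1 1 n * a n t * m.coeff lam 1 1 n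
  have := ha n hn
  nlinarith [mul_nonneg (sq_nonneg (m.coeff lam 1 1 n)) this]

/-- The quadratic part of the equation in the decomposition `u = x e_1 + u_s`. -/
lemma B_self_eq (u : V) : m.B u u = m.low lam u ^ 2 • m.forcing lam +
    m.low lam u • (m.B (m.eV lam 1) (m.high lam u) + m.B (m.high lam u) (m.eV lam 1)) +
    m.B (m.high lam u) (m.high lam u) := by
  have h : u = m.low lam u • m.eV lam 1 + m.high lam u := by rw [high]; abel
  have e : m.B u u = m.B (m.low lam u • m.eV lam 1 + m.high lam u)
    (m.low lam u • m.eV lam 1 + m.high lam u) := by rw [← h]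
  rw [e, forcing]
  simp only [map_add, map_smul, _root_.add_apply, _root_.smul_apply]
  module

namespace SpectralBounds

variable (hs : m.SpectralBounds lam N c C η δ κ)
include hs

lemma inner_profile_e (t : ℝ) : ⟪(m.profile lam N a t : H), (m.e lam 1 : H)⟫ = 0 := by
  rw [coe_profile, sum_inner]
  refine Finset.sum_eq_zero fun n hn => ?_
  have h2 : (2 : ℕ+) ≤ n := (Finset.mem_Icc.1 hn).1
  have hne : n ≠ 1 := by rintro rfl; exact absurd h2 (by decide)
  rw [inner_smul_left, hs.orthonormal.2 hne, mul_zero]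

lemma norm_coeff_le (n : ℕ+) : |m.coeff lam 1 1 n| ≤ ‖m.B‖ * κ ^ 2 := by
  have h := abs_real_inner_le_norm (m.forcing lam) (m.e lam n : H)
  rw [hs.norm_e, mul_one] at h
  exact h.trans hs.norm_forcing_le

lemma norm_profile_le {M t : ℝ} (ha : ∀ n ∈ Finset.Icc 2 N, |a n t| ≤ M) :
    ‖(m.profile lam N a t : H)‖ ≤ (Finset.Icc 2 N).card * (‖m.B‖ * κ ^ 2 * M) := by
  rw [coe_profile, ← nsmul_eq_mul]
  refine norm_sum_le_of_le _ (fun n hn => ?_) |>.trans (Finset.sum_const _).le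
  rw [norm_smul, hs.norm_e, mul_one, Real.norm_eq_abs, abs_mul]
  have hκ := hs.κ_nonneg
  gcongr
  · exact hs.norm_coeff_le n
  · exact ha n hn

/-- The shift by `2ε` offsets the linear growth of `Y²`: in the equation for `Y² ψ` it cancels,
leaving `L_λ`, the quadratic forcing and a term of order `Y⁴`. -/
lemma hasDerivAt_profile {t : ℝ} (ha : ∀ n ∈ Finset.Icc 2 N,
      HasDerivAt (a n) (-(2 * m.β lam 1 - m.β lam n) * a n t + Real.exp (g t)) t) :
    HasDerivAt (fun t => (m.profile lam N a t : H))
      (m.Lmap lam (m.profile lam N a t) - (2 * m.β lam 1) • (m.profile lam N a t : H)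
        + Real.exp (g t) • m.forcing lam) t := by
  have h : HasDerivAt (fun t => ∑ n ∈ Finset.Icc 2 N, (m.coeff lam 1 1 n * a n t) • (m.e lam n : H))
      (∑ n ∈ Finset.Icc 2 N, (m.coeff lam 1 1 n *
        (-(2 * m.β lam 1 - m.β lam n) * a n t + Real.exp (g t))) • (m.e lam n : H)) t := by
    refine HasDerivAt.fun_sum fun n hn => ?_
    exact ((ha n hn).const_mul _).smul_const _
  have e : (fun t => (m.profile lam N a t : H)) =
      fun t => ∑ n ∈ Finset.Icc 2 N, (m.coeff lam 1 1 n * a n t) • (m.e lam n : H) := by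
    ext t; exact coe_profile t
  rw [e]
  convert! h using 1
  rw [coe_profile, hs.forcing_eq, profile, map_sum, Finset.smul_sum, Finset.smul_sum,
    ← Finset.sum_sub_distrib, ← Finset.sum_add_distrib]
  refine Finset.sum_congr rfl fun n _ => ?_
  rw [map_smul, hs.eigen]
  module

/-- The amplitude of a solution of the reduced equation grows at most linearly. -/
lemma reduced_sq_le {Y : ℝ → ℝ} {b : ℝ} (hY : ContinuousOn Y (Icc 0 b))
    (ha : ∀ t ∈ Icc 0 b, ∀ n ∈ Finset.Icc 2 N, 0 ≤ a n t)
    (hY' : ∀ t ∈ Ioo 0 b, HasDerivAt Y (m.β lam 1 * Y t -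
      Real.exp (g t) * Y t ^ 3 * ⟪m.forcing lam, (m.profile lam N a t : H)⟫) t)
    {t : ℝ} (ht : t ∈ Icc 0 b) : Y t ^ 2 ≤ Y 0 ^ 2 * Real.exp (2 * m.β lam 1 * t) := by
  have hε := hs.β_pos
  have h := le_mul_exp_of_deriv_le (a := 0) (b := b) (k := 2 * m.β lam 1) (c := 0)
    (by positivity) le_rfl (hY.pow 2) (fun t ht => (hY' t ht).pow 2) ?_ ht
  · simpa using h
  · intro t ht
    have h1 := inner_forcing_profile_nonneg (m := m) (lam := lam) (ha t ⟨ht.1.le, ht.2.le⟩)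
    have h2 : 0 ≤ Real.exp (g t) * Y t ^ 4 * ⟪m.forcing lam, (m.profile lam N a t : H)⟫ := by
      positivity
    simp only [Pi.pow_apply]
    push_cast
    nlinarith

set_option maxHeartbeats 1000000 in
/-- Comparison of the full equation with the reduced one, along a fixed path of the noise. -/
lemma exists_comparison_bound {J : Set ℝ} {w : ℝ → V} {D : ℝ → m.A.domain}
    (hw : m.IsPathSolution lam g J w D) {Y : ℝ → ℝ} {b s G C₁ C₂ K₀ M k T : ℝ}
    (hb : b ∈ J) (hβ : m.β lam 1 = s ^ 2) (hs0 : 0 < s) (hs1 : s ≤ 1) (hbT : s ^ 2 * b ≤ T)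
    (hC₁ : 0 ≤ C₁) (hC₂ : 0 ≤ C₂) (hG : 0 ≤ G)
    (hg : ∀ t ∈ Icc 0 b, Real.exp (g t) ≤ G)
    (hlow : ∀ t ∈ Icc 0 b, |m.low lam (w t)| ≤ C₁ * s)
    (hhigh : ∀ t ∈ Icc 0 b, ‖m.high lam (w t)‖ ≤ C₂ * s ^ 2)
    (hY : ContinuousOn Y (Icc 0 b)) (hYb : ∀ t ∈ Icc 0 b, |Y t| ≤ C₁ * s)
    (ha : ∀ t ∈ Icc 0 b, ∀ n ∈ Finset.Icc 2 N, 0 ≤ a n t)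
    (ha' : ∀ t ∈ Icc 0 b, ∀ n ∈ Finset.Icc 2 N,
      HasDerivAt (a n) (-(2 * m.β lam 1 - m.β lam n) * a n t + Real.exp (g t)) t)
    (hM : ∀ t ∈ Icc 0 b, ‖(m.profile lam N a t : H)‖ ≤ M)
    (hY' : ∀ t ∈ Ioo 0 b, HasDerivAt Y (m.β lam 1 * Y t -
      Real.exp (g t) * Y t ^ 3 * ⟪m.forcing lam, (m.profile lam N a t : H)⟫) t)
    (hY0 : Y 0 = m.low lam (w 0))
    (hr0 : ‖m.emb (m.high lam (w 0)) - Y 0 ^ 2 • (m.profile lam N a 0 : H)‖ ≤ K₀ * s ^ 3)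
    (hk : G * (2 * C₁ * (‖m.B‖ * κ ^ 2) + ‖m.B‖ * C₂ ^ 2 + 2 * C₁ * ‖m.B‖ * κ * C₂ +
      2 * C₁ ^ 4 * (‖m.B‖ * κ ^ 2) * M ^ 2) ≤ k)
    {t : ℝ} (ht : t ∈ Icc 0 b) :
    (m.low lam (w t) - Y t) ^ 2 ≤
      (K₀ ^ 2 + 1) * Real.exp ((2 + k + 4 * (k ^ 2 / δ)) * T) * s ^ 4 ∧
    ‖m.emb (m.high lam (w t)) - Y t ^ 2 • (m.profile lam N a t : H)‖ ^ 2 ≤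
      (K₀ ^ 2 + 2 * (k ^ 2 / δ) *
      ((K₀ ^ 2 + 1) * Real.exp ((2 + k + 4 * (k ^ 2 / δ)) * T) + 1) / δ) * s ^ 6 := by
  have hκ := hs.κ_nonneg
  have hM0 : 0 ≤ M := (norm_nonneg _).trans (hM t ht)
  have hJ := hw.mem b hb
  have hJ' : ∀ t ∈ Ioo 0 b, t ∈ J ∩ Ioi 0 := fun t ht => ⟨hJ ⟨ht.1.le, ht.2.le⟩, ht.1⟩
  have hmem : ∀ t ∈ Ioo 0 b, t ∈ Icc 0 b := fun t ht => ⟨ht.1.le, ht.2.le⟩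
  set F := ‖m.B‖ * κ ^ 2 with hF
  have hF0 : 0 ≤ F := by positivity
  have hf1 := hs.norm_forcing_le
  rw [← hF] at hf1
  set ψ : ℝ → H := fun t => (m.profile lam N a t : H) with hψ
  set r : ℝ → H := fun t => m.emb (m.high lam (w t)) - Y t ^ 2 • ψ t with hr
  set S : ℝ → ℝ := fun t => ⟪m.forcing lam, ψ t⟫ with hS
  have hS0 : ∀ t ∈ Icc 0 b, 0 ≤ S t := fun t ht => inner_forcing_profile_nonneg (ha t ht)
  have hSM : ∀ t ∈ Icc 0 b, S t ≤ F * M := fun t ht =>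
    (real_inner_le_norm _ _).trans (by gcongr; exact hM t ht)
  -- The four contributions to the fast error, in order: `(x² - Y²) f`, the quadratic term in the
  -- stable modes, the mixed terms with `e_1`, and the cubic term of the reduced equation acting
  -- through the derivative of `Y²`. The first two also cover the slow error.
  set p1 := G * (2 * C₁ * F) with hp1
  set p2 := G * (‖m.B‖ * C₂ ^ 2) with hp2
  set p3 := G * (2 * C₁ * ‖m.B‖ * κ * C₂) with hp3
  set p4 := G * (2 * C₁ ^ 4 * F * M ^ 2) with hp4
  have hp1' : 0 ≤ p1 := by positivity
  have hp2' : 0 ≤ p2 := by positivity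
  have hp3' : 0 ≤ p3 := by positivity
  have hp4' : 0 ≤ p4 := by positivity
  have hk' : p1 + p2 + p3 + p4 ≤ k := by rw [hp1, hp2, hp3, hp4]; linarith
  have hs43 : s ^ 4 ≤ s ^ 3 := pow_le_pow_of_le_one hs0.le hs1 (by norm_num)
  have hψd : ∀ t ∈ Icc 0 b, HasDerivAt ψ (m.Lmap lam (m.profile lam N a t) -
      (2 * m.β lam 1) • ψ t + Real.exp (g t) • m.forcing lam) t :=
    fun t ht => hs.hasDerivAt_profile (ha' t ht)
  have hBhh : ∀ t ∈ Icc 0 b, ‖m.B (m.high lam (w t)) (m.high lam (w t))‖ ≤ ‖m.B‖ * C₂ ^ 2 * s ^ 4 := by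
    intro t ht
    refine (m.B.le_opNorm₂ _ _).trans ?_
    have := hhigh t ht
    calc _ ≤ ‖m.B‖ * (C₂ * s ^ 2) * (C₂ * s ^ 2) := by gcongr
      _ = _ := by ring
  have hB1h : ∀ t ∈ Icc 0 b, ‖m.B (m.eV lam 1) (m.high lam (w t)) +
      m.B (m.high lam (w t)) (m.eV lam 1)‖ ≤ 2 * ‖m.B‖ * κ * C₂ * s ^ 2 := by
    intro t ht
    have h1 := hhigh t ht
    have h2 := hs.eV_le
    have h3 : ‖m.B (m.eV lam 1) (m.high lam (w t))‖ ≤ ‖m.B‖ * κ * (C₂ * s ^ 2) :=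
      (m.B.le_opNorm₂ _ _).trans (by gcongr)
    have h4 : ‖m.B (m.high lam (w t)) (m.eV lam 1)‖ ≤ ‖m.B‖ * (C₂ * s ^ 2) * κ :=
      (m.B.le_opNorm₂ _ _).trans (by gcongr)
    refine (norm_add_le _ _).trans ?_
    linarith
  have hlowd := fun t ht => hw.hasDerivAt_low hs (hJ' t ht)
  have hrd : ∀ t ∈ Ioo 0 b, HasDerivAt r
      (m.Lmap lam (m.highD lam (D t) - Y t ^ 2 • m.profile lam N a t) +
        Real.exp (g t) • (m.proj lam (m.B (w t) (w t)) - Y t ^ 2 • m.forcing lam +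
          (2 * Y t ^ 4 * S t) • ψ t)) t := by
    intro t ht
    have h1 := (hw.hasDerivAt_high hs (hJ' t ht)).sub
      (((hY' t ht).pow 2).smul (hψd t (hmem t ht)))
    convert! h1 using 1
    rw [map_sub, map_smul]
    simp only [Pi.pow_apply]
    push_cast
    module
  have hrdom : ∀ t ∈ Ioo 0 b, r t = ((m.highD lam (D t) - Y t ^ 2 • m.profile lam N a t : m.A.domain) : H) := by
    intro t ht
    rw [hr]
    simp only
    rw [← hw.incl t (hJ' t ht), ← hs.incl_highD, hs.emb_incl]
    rfl
  have hr1 : ∀ t, ⟪r t, (m.e lam 1 : H)⟫ = 0 := by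
    intro t
    rw [hr]
    simp only
    rw [inner_sub_left, inner_smul_left, hs.emb_high, hs.inner_proj_e, hψ]
    simp only
    rw [hs.inner_profile_e]
    simp
  have hhr : ∀ t, ⟪m.forcing lam, m.emb (m.high lam (w t))⟫ =
      ⟪m.forcing lam, r t⟫ + Y t ^ 2 * S t := by
    intro t
    rw [hr]
    simp only
    rw [inner_sub_right, inner_smul_right]
    ring
  have hcontlow : ContinuousOn (fun t => m.low lam (w t)) (Icc 0 b) :=
    (m.emb.continuous.comp_continuousOn (hw.cont.mono hJ)).inner continuousOn_const
  have hcontr : ContinuousOn r (Icc 0 b) :=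
    (m.emb.continuous.comp_continuousOn ((hw.cont.mono hJ).sub
      (hcontlow.smul continuousOn_const))).sub
      ((hY.pow 2).smul fun t ht => (hψd t ht).continuousAt.continuousWithinAt)
  refine slow_fast_estimate (z := fun t => m.low lam (w t) - Y t) (ρ := fun t => ‖r t‖)
    hs.δ_pos hs0 hs1 (by linarith) hbT (hcontlow.sub hY) hcontr.norm
    (fun t ht => (hlowd t ht).sub (hY' t ht)) (fun t ht => (hrd t ht).norm_sq) ?_ ?_
    (by rw [hY0, sub_self]) (by gcongr) ht
  · intro t ht
    have htm := hmem t ht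
    set z := m.low lam (w t) - Y t with hz
    -- The forcing is orthogonal to `e_1`, the mixed terms reduce to a pairing with `f` by `Fc_eq`,
    -- and the stable part is split as `r + Y² ψ`.
    have e1 : ⟪m.B (w t) (w t), (m.e lam 1 : H)⟫ = -(m.low lam (w t) * ⟪m.forcing lam, r t⟫)
        - m.low lam (w t) * (Y t ^ 2 * S t) +
        ⟪m.B (m.high lam (w t)) (m.high lam (w t)), (m.e lam 1 : H)⟫ := by
      have h1 := hs.Fc_eq (m.high lam (w t))
      rw [Fc, hhr] at h1
      rw [B_self_eq (w t), inner_add_left, inner_add_left, inner_smul_left, inner_smul_left,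
        hs.inner_forcing_e, h1]
      simp only [RCLike.conj_to_real]
      ring
    have h2 : |⟪m.forcing lam, r t⟫| ≤ F * ‖r t‖ :=
      (abs_real_inner_le_norm _ _).trans (by gcongr)
    have h3 : |⟪m.B (m.high lam (w t)) (m.high lam (w t)), (m.e lam 1 : H)⟫| ≤
        ‖m.B‖ * C₂ ^ 2 * s ^ 4 := by
      refine (abs_real_inner_le_norm _ _).trans ?_
      rw [hs.norm_e, mul_one]
      exact hBhh t htm
    have h4 := hg t htm
    have h5 := Real.exp_pos (g t)
    -- The cubic terms of the two equations combine to `-e^g z² Y² ⟨f, ψ⟩`, which has a favourable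
    -- sign and is discarded.
    have h6 : 0 ≤ Real.exp (g t) * (z ^ 2 * (Y t ^ 2 * S t)) := by
      have := hS0 t htm
      positivity
    have h7 : Real.exp (g t) * (-(m.low lam (w t) * ⟪m.forcing lam, r t⟫ * z)) ≤
        G * ((C₁ * s) * (F * ‖r t‖) * |z|) := by
      refine (le_abs_self _).trans ?_
      rw [abs_mul, abs_neg, abs_mul, abs_mul, abs_of_pos h5]
      have := hlow t htm
      gcongr
    have h8 : Real.exp (g t) * (⟪m.B (m.high lam (w t)) (m.high lam (w t)), (m.e lam 1 : H)⟫ * z) ≤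
        G * (‖m.B‖ * C₂ ^ 2 * s ^ 4 * |z|) := by
      refine (le_abs_self _).trans ?_
      rw [abs_mul, abs_mul, abs_of_pos h5]
      gcongr
    have h9 : p1 * (s * ‖r t‖ * |z|) ≤ 2 * k * (s * ‖r t‖ * |z|) := by
      gcongr
      linarith
    have h10 : p2 * (s ^ 4 * |z|) ≤ k * (s ^ 4 * |z|) := by
      gcongr
      linarith
    rw [e1, hβ]
    have e2 : z * (s ^ 2 * m.low lam (w t) + Real.exp (g t) *
        (-(m.low lam (w t) * ⟪m.forcing lam, r t⟫) - m.low lam (w t) * (Y t ^ 2 * S t) +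
        ⟪m.B (m.high lam (w t)) (m.high lam (w t)), (m.e lam 1 : H)⟫) -
        (s ^ 2 * Y t - Real.exp (g t) * Y t ^ 3 * S t)) =
        s ^ 2 * z ^ 2 + Real.exp (g t) * (-(m.low lam (w t) * ⟪m.forcing lam, r t⟫ * z)) +
        Real.exp (g t) * (⟪m.B (m.high lam (w t)) (m.high lam (w t)), (m.e lam 1 : H)⟫ * z) -
        Real.exp (g t) * (z ^ 2 * (Y t ^ 2 * S t)) := by
      rw [hz]; ring
    rw [e2]
    rw [hp1] at h9
    rw [hp2] at h10
    linarith
  · intro t ht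
    have htm := hmem t ht
    set z := m.low lam (w t) - Y t with hz
    gcongr
    have h1 := hs.inner_Lmap_le (w := m.highD lam (D t) - Y t ^ 2 • m.profile lam N a t)
      (by rw [← hrdom t ht]; exact hr1 t)
    rw [← hrdom t ht] at h1
    rw [real_inner_comm, inner_add_left, inner_smul_left]
    have e1 : ⟪m.proj lam (m.B (w t) (w t)) - Y t ^ 2 • m.forcing lam +
          (2 * Y t ^ 4 * S t) • ψ t, r t⟫ =
        z * (m.low lam (w t) + Y t) * ⟪m.forcing lam, r t⟫ +
        m.low lam (w t) * ⟪m.B (m.eV lam 1) (m.high lam (w t)) +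
          m.B (m.high lam (w t)) (m.eV lam 1), r t⟫ +
        ⟪m.B (m.high lam (w t)) (m.high lam (w t)), r t⟫ + 2 * Y t ^ 4 * S t * ⟪ψ t, r t⟫ := by
      rw [inner_add_left, inner_sub_left, inner_proj (hr1 t), B_self_eq (w t)]
      rw [inner_add_left (m.low lam (w t) ^ 2 • m.forcing lam + _),
        inner_add_left (m.low lam (w t) ^ 2 • m.forcing lam)]
      simp only [inner_smul_left, RCLike.conj_to_real]
      rw [hz]
      ring
    have hl := hlow t htm
    have hy := hYb t htm
    have i1 : |z * (m.low lam (w t) + Y t) * ⟪m.forcing lam, r t⟫| ≤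
        |z| * (2 * C₁ * s) * (F * ‖r t‖) := by
      rw [abs_mul, abs_mul]
      have h2 : |⟪m.forcing lam, r t⟫| ≤ F * ‖r t‖ :=
        (abs_real_inner_le_norm _ _).trans (by gcongr)
      have h3 : |m.low lam (w t) + Y t| ≤ 2 * C₁ * s := (abs_add_le _ _).trans (by linarith)
      gcongr
    have i2 : |m.low lam (w t) * ⟪m.B (m.eV lam 1) (m.high lam (w t)) +
          m.B (m.high lam (w t)) (m.eV lam 1), r t⟫| ≤
        C₁ * s * (2 * ‖m.B‖ * κ * C₂ * s ^ 2 * ‖r t‖) := by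
      rw [abs_mul]
      have h2 := abs_real_inner_le_norm (m.B (m.eV lam 1) (m.high lam (w t)) +
          m.B (m.high lam (w t)) (m.eV lam 1)) (r t)
      have h3 := hB1h t htm
      gcongr
      exact h2.trans (by gcongr)
    have i3 : |⟪m.B (m.high lam (w t)) (m.high lam (w t)), r t⟫| ≤
        ‖m.B‖ * C₂ ^ 2 * s ^ 4 * ‖r t‖ := by
      refine (abs_real_inner_le_norm _ _).trans ?_
      gcongr
      exact hBhh t htm
    have i4 : |2 * Y t ^ 4 * S t * ⟪ψ t, r t⟫| ≤ 2 * (C₁ * s) ^ 4 * (F * M) * (M * ‖r t‖) := by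
      rw [abs_mul, abs_mul, abs_mul, abs_pow, abs_two, abs_of_nonneg (hS0 t htm)]
      have h2 : |⟪ψ t, r t⟫| ≤ M * ‖r t‖ := (abs_real_inner_le_norm _ _).trans (by
        gcongr
        exact hM t htm)
      have h3 := hSM t htm
      have := hS0 t htm
      gcongr
    rw [e1]
    have h5 := Real.exp_pos (g t)
    set q1 := z * (m.low lam (w t) + Y t) * ⟪m.forcing lam, r t⟫
    set q2 := m.low lam (w t) * ⟪m.B (m.eV lam 1) (m.high lam (w t)) +
          m.B (m.high lam (w t)) (m.eV lam 1), r t⟫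
    set q3 := ⟪m.B (m.high lam (w t)) (m.high lam (w t)), r t⟫
    set q4 := 2 * Y t ^ 4 * S t * ⟪ψ t, r t⟫
    have h6 : Real.exp (g t) * (q1 + q2 + q3 + q4) ≤ G * (|z| * (2 * C₁ * s) * (F * ‖r t‖) +
        C₁ * s * (2 * ‖m.B‖ * κ * C₂ * s ^ 2 * ‖r t‖) + ‖m.B‖ * C₂ ^ 2 * s ^ 4 * ‖r t‖ +
        2 * (C₁ * s) ^ 4 * (F * M) * (M * ‖r t‖)) := by
      refine (le_abs_self _).trans ?_
      rw [abs_mul, abs_of_pos h5]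
      have h7 : |q1 + q2 + q3 + q4| ≤ |q1| + |q2| + |q3| + |q4| := by
        refine (abs_add_le _ _).trans ?_
        gcongr
        exact abs_add_three _ _ _
      have h8 := hg t htm
      have h9 : |q1 + q2 + q3 + q4| ≤ |z| * (2 * C₁ * s) * (F * ‖r t‖) +
        C₁ * s * (2 * ‖m.B‖ * κ * C₂ * s ^ 2 * ‖r t‖) + ‖m.B‖ * C₂ ^ 2 * s ^ 4 * ‖r t‖ +
        2 * (C₁ * s) ^ 4 * (F * M) * (M * ‖r t‖) := by linarith
      gcongr
    have e3 : G * (|z| * (2 * C₁ * s) * (F * ‖r t‖) +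
        C₁ * s * (2 * ‖m.B‖ * κ * C₂ * s ^ 2 * ‖r t‖) + ‖m.B‖ * C₂ ^ 2 * s ^ 4 * ‖r t‖ +
        2 * (C₁ * s) ^ 4 * (F * M) * (M * ‖r t‖)) =
        p1 * (s * |z| * ‖r t‖) + p3 * (s ^ 3 * ‖r t‖) + (p2 + p4) * (s ^ 4 * ‖r t‖) := by
      rw [hp1, hp2, hp3, hp4]; ring
    have h10 : (p2 + p4) * (s ^ 4 * ‖r t‖) ≤ (p2 + p4) * (s ^ 3 * ‖r t‖) := by gcongr
    have h11 : p1 * (s * |z| * ‖r t‖) ≤ k * (s * |z| * ‖r t‖) := by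
      gcongr
      linarith
    have h12 : (p3 + (p2 + p4)) * (s ^ 3 * ‖r t‖) ≤ k * (s ^ 3 * ‖r t‖) := by
      gcongr
      linarith
    rw [e3] at h6
    simp only [RCLike.conj_to_real]
    linarith

end SpectralBounds

end Comparison

end Model

/-! ### Life spans -/

lemma Icc_subset_lifeSpan {τ : WithTop ℝ≥0} {t : ℝ} (ht : t ∈ lifeSpan τ) :
    Icc 0 t ⊆ lifeSpan τ := fun _ hs =>
  ⟨hs.1, lt_of_le_of_lt (WithTop.coe_le_coe.2 (Real.toNNReal_le_toNNReal hs.2)) ht.2⟩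

lemma isOpen_lifeSpan_inter (τ : WithTop ℝ≥0) : IsOpen (lifeSpan τ ∩ Ioi 0) := by
  induction τ with
  | top =>
    convert isOpen_Ioi (a := (0 : ℝ)) using 1
    ext t
    simp only [lifeSpan, mem_inter_iff, mem_ofPred_eq, mem_Ioi, WithTop.coe_lt_top, and_true,
      and_iff_right_iff_imp]
    exact le_of_lt
  | coe x =>
    convert isOpen_Ioo (a := (0 : ℝ)) (b := (x : ℝ)) using 1
    ext t
    simp only [lifeSpan, mem_inter_iff, mem_ofPred_eq, mem_Ioi, mem_Ioo, WithTop.coe_lt_coe]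
    constructor
    · rintro ⟨⟨h1, h2⟩, h3⟩
      exact ⟨h3, (Real.toNNReal_lt_iff_lt_coe h1).1 h2⟩
    · rintro ⟨h1, h2⟩
      exact ⟨⟨h1.le, (Real.toNNReal_lt_iff_lt_coe h1.le).2 h2⟩, h1⟩

lemma rpow_three_halves_eq {x : ℝ} (hx : 0 ≤ x) : x ^ (3 / 2 : ℝ) = √x ^ 3 := by
  rw [Real.rpow_div_two_eq_sqrt _ hx, ← Real.rpow_natCast]
  norm_num

/-! ### Spectral constants uniform in the parameter, and removal of the noise. -/

namespace Model

lemma exists_opNorm_bound {E F : Type*} [NormedAddCommGroup E] [NormedSpace ℝ E]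
    [NormedAddCommGroup F] [NormedSpace ℝ F] {P : ℝ → E →L[ℝ] F} {K : Set ℝ} (hK : IsCompact K)
    (hP : ContinuousOn P K) : ∃ Q, 0 ≤ Q ∧ ∀ l ∈ K, ∀ x, ‖P l x‖ ≤ Q * ‖x‖ := by
  obtain ⟨Q, hQ⟩ := hK.exists_bound_of_continuousOn hP
  exact ⟨max Q 0, le_max_right _ _, fun l hl x =>
    (P l).le_of_opNorm_le ((hQ l hl).trans (le_max_left _ _)) x⟩

/-- The linear part satisfies bounds that are uniform in the parameter. -/
lemma exists_spectralBounds {H V : Type*} [NormedAddCommGroup H] [InnerProductSpace ℝ H]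
    [CompleteSpace H] [NormedAddCommGroup V] [NormedSpace ℝ V] {m : Model H V} {N : ℕ+}
    (hm : m.FunctionalSetting) (hA1 : m.CondA1) (hA2 : m.CondA2)
    (hsymm : ∀ w z : m.A.domain, ⟪m.A w, (z : H)⟫ = ⟪(w : H), m.A z⟫)
    (hequiv : ∃ c > (0 : ℝ), ∃ C > (0 : ℝ), ∀ w : m.A.domain,
      c * ‖m.incl w‖ ^ 2 ≤ ⟪m.A w, (w : H)⟫ ∧ ⟪m.A w, (w : H)⟫ ≤ C * ‖m.incl w‖ ^ 2)
    (hL2 : m.CondL2) (hA3 : m.CondA3 N) :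
    ∃ c C η δ κ : ℝ, ∀ lam ∈ Ioc m.lamC m.lamS, m.SpectralBounds lam N c C η δ κ := by
  obtain ⟨c, hc, C, hC, hcC⟩ := hequiv
  obtain ⟨η, hη, δ, hδ, hdamp⟩ := hL2
  obtain ⟨Q, hQ0, hQ⟩ := exists_opNorm_bound isCompact_Icc (hm.P_cont.mono hm.Icc_subset)
  refine ⟨c, C, η, δ, Q / c, fun lam hlam => ?_⟩
  have hIcc : lam ∈ Icc m.lamC m.lamS := ⟨hlam.1.le, hlam.2⟩
  have hnhd := hm.Icc_subset hIcc
  have horth := hm.orthonormal lam hnhd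
  have hβ := hA2.pos lam hnhd hlam.1
  have heig : ∀ n : ℕ+, m.Lmap lam (m.e lam n) = m.β lam n • (m.e lam n : H) :=
    hm.eigen lam hnhd
  have hself : ⟪(m.e lam 1 : H), (m.e lam 1 : H)⟫ = 1 := by
    rw [real_inner_self_eq_norm_sq, horth.1 1]; norm_num
  exact
  { emb_incl := hm.emb_incl
    symmA := hsymm
    symmL := by
      intro w z
      have h : (m.L lam).adjoint.IsFormalAdjoint (m.L lam) :=
        LinearPMap.adjoint_isFormalAdjoint hm.dense
      have hsa : (m.L lam).adjoint = m.L lam := hA1 lam hnhd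
      rw [hsa] at h
      exact h w z
    c_pos := hc
    C_pos := hC
    η_lt := hη.2
    δ_pos := hδ
    κ_nonneg := by positivity
    β_pos := hβ
    lower := fun w => (hcC w).1
    upper := fun w => (hcC w).2
    orthonormal := horth
    eigen := heig
    damping := hdamp lam hIcc
    energy := hA3.energy
    forcing_eq := by
      -- The difference is orthogonal to every `e_n`, hence zero by totality: `n = 1` is energy
      -- conservation, `n > N` is finite interaction, and the remaining `n` cancel.
      have hzero : ∀ n : ℕ+, ⟪m.forcing lam -
          ∑ k ∈ Finset.Icc 2 N, m.coeff lam 1 1 k • (m.e lam k : H), (m.e lam n : H)⟫ = 0 := by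
        intro n
        have hf : ⟪m.forcing lam, (m.e lam n : H)⟫ = m.coeff lam 1 1 n := rfl
        rw [inner_sub_left, hf, sum_inner]
        have h1 : ∀ k ∈ Finset.Icc 2 N,
            ⟪m.coeff lam 1 1 k • (m.e lam k : H), (m.e lam n : H)⟫ =
            if k = n then m.coeff lam 1 1 n else 0 := by
          intro k _
          rw [inner_smul_left, orthonormal_iff_ite.1 horth k n]
          split_ifs with hkn
          · subst hkn; simp
          · simp
        rw [Finset.sum_congr rfl h1, Finset.sum_ite_eq']
        split_ifs with hn
        · simp
        · rw [sub_zero]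
          rw [Finset.mem_Icc, not_and_or, not_le, not_le] at hn
          rcases hn with hn | hn
          · have : n = 1 := by
              have h2 : n < 1 + 1 := hn
              exact le_antisymm (PNat.lt_add_one_iff.1 h2) one_le
            subst this
            have h3 := hA3.energy (m.eV lam 1)
            rwa [show m.emb (m.eV lam 1) = (m.e lam 1 : H) from hm.emb_incl _] at h3
          · exact hA3.finite lam hIcc n hn
      have hspan : Submodule.span ℝ (range fun n : ℕ+ => (m.e lam n : H)) ≤
          (Submodule.span ℝ {m.forcing lam -
          ∑ k ∈ Finset.Icc 2 N, m.coeff lam 1 1 k • (m.e lam k : H)})ᗮ := by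
        rw [Submodule.span_le]
        rintro _ ⟨n, rfl⟩
        exact Submodule.mem_orthogonal_singleton_iff_inner_right.2 (hzero n)
      have htop : (m.forcing lam -
          ∑ k ∈ Finset.Icc 2 N, m.coeff lam 1 1 k • (m.e lam k : H)) ∈
          (Submodule.span ℝ {m.forcing lam -
          ∑ k ∈ Finset.Icc 2 N, m.coeff lam 1 1 k • (m.e lam k : H)})ᗮ := by
        have h4 := Submodule.topologicalClosure_minimal _ hspan (Submodule.isClosed_orthogonal _)
        rw [hm.total lam hnhd] at h4
        exact h4 Submodule.mem_top
      rw [Submodule.mem_orthogonal_singleton_iff_inner_right, inner_self_eq_zero] at htop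
      exact sub_eq_zero.1 htop
    eV_le := by
      -- Since `⟨L_λ e_1, e_1⟩ > 0`, one has `c ‖e_1‖_V² ≤ ⟨A e_1, e_1⟩ ≤ ⟨P_λ e_1, e_1⟩ ≤ Q
      -- ‖e_1‖_V`, a bound uniform in `λ`.
      have h1 := (hcC (m.e lam 1)).1
      have h2 : ⟪m.Lmap lam (m.e lam 1), (m.e lam 1 : H)⟫ = m.β lam 1 := by
        rw [heig, inner_smul_left, hself]; simp
      rw [Lmap_apply, inner_add_left, inner_neg_left] at h2
      have h3 : ⟪m.P lam (m.incl (m.e lam 1)), (m.e lam 1 : H)⟫ ≤ Q * ‖m.incl (m.e lam 1)‖ := by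
        refine (real_inner_le_norm _ _).trans ?_
        rw [horth.1 1, mul_one]
        exact hQ lam hIcc _
      change ‖m.incl (m.e lam 1)‖ ≤ Q / c
      rw [le_div_iff₀ hc]
      rcases (norm_nonneg (m.incl (m.e lam 1))).eq_or_lt with h0 | h0
      · rw [← h0]; simpa using hQ0
      · have h4 : c * ‖m.incl (m.e lam 1)‖ ^ 2 ≤ Q * ‖m.incl (m.e lam 1)‖ := by linarith
        nlinarith }

section Pathwise

variable {H V : Type*} [NormedAddCommGroup H] [InnerProductSpace ℝ H]
  [NormedAddCommGroup V] [NormedSpace ℝ V] {m : Model H V}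
  {Ω : Type*} {N : ℕ+} {lam c C η δ κ : ℝ}

/-- The coefficients `e^{σ W_t} M_{11}^n(t)`. -/
def scaledMterm (m : Model H V) (W : ℝ → Ω → ℝ) (lam : ℝ) (ω : Ω) (n : ℕ+) : ℝ → ℝ :=
  expAverage (2 * m.β lam 1 - m.β lam n) (fun t => m.noise lam * W t ω)

lemma scaledMterm_eq (W : ℝ → Ω → ℝ) (ω : Ω) (n : ℕ+) (t : ℝ) :
    m.scaledMterm W lam ω n t = Real.exp (m.noise lam * W t ω) * m.Mterm W lam n t ω := by
  rw [scaledMterm, expAverage, Mterm, ← integral_const_mul]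
  congr 1; ext s
  rw [← Real.exp_add]
  ring_nf

namespace SpectralBounds

variable (hs : m.SpectralBounds lam N c C η δ κ)
include hs

/-- Testing the damping condition on an eigenvector gives a spectral gap uniform in `λ` and `n`. -/
lemma β_le {n : ℕ+} (hn : 2 ≤ n) : m.β lam n ≤ -δ := by
  have hne : n ≠ 1 := by rintro rfl; exact absurd hn (by decide)
  have h := hs.inner_Lmap_le (w := m.e lam n) (hs.orthonormal.2 hne)
  rw [hs.eigen, inner_smul_left, hs.inner_self_e, hs.norm_e] at h
  simpa using h

lemma emb_Phi (W : ℝ → Ω → ℝ) (x t : ℝ) (ω : Ω) :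
    m.emb (m.Phi N W lam x t ω) = (x ^ 2 * Real.exp (-(m.noise lam * W t ω))) •
      (m.profile lam N (m.scaledMterm W lam ω) t : H) := by
  rw [Phi, map_sum, coe_profile, Finset.smul_sum]
  refine Finset.sum_congr rfl fun n _ => ?_
  rw [map_smul, hs.emb_eV, scaledMterm_eq, smul_smul, Real.exp_neg]
  congr 1
  field_simp

/-- The transformation `w = e^{-σ W} u` of a solution of the stochastic equation. -/
lemma exists_isPathSolution (hinj : Function.Injective m.emb) {W : ℝ → Ω → ℝ} {ω : Ω} {R : ℝ}
    (hc : Continuous fun t => W t ω) (hR : ∀ s, |W s ω| ≤ R * (1 + |s|))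
    {τ : WithTop ℝ≥0} {u : ℝ → V} {v : ℝ → V} {g : ℝ → H}
    (hv : ∀ t ∈ lifeSpan τ, v t = Real.exp (-ou W (m.noise lam) t ω) • u t)
    (hvc : ContinuousOn v (lifeSpan τ)) (hgc : ContinuousOn g (lifeSpan τ ∩ Ioi 0))
    (hd : ∀ t ∈ lifeSpan τ ∩ Ioi 0, (m.emb (v t), g t) ∈ m.A.graph ∧
      HasDerivAt (fun s => m.emb (v s))
        (-g t + m.P lam (v t) + ou W (m.noise lam) t ω • m.emb (v t)
          + Real.exp (-ou W (m.noise lam) t ω) •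
              m.B (Real.exp (ou W (m.noise lam) t ω) • v t)
                (Real.exp (ou W (m.noise lam) t ω) • v t)) t) :
    ∃ (w : ℝ → V) (D : ℝ → m.A.domain),
      m.IsPathSolution lam (fun t => m.noise lam * W t ω) (lifeSpan τ) w D ∧
      ∀ t ∈ lifeSpan τ, w t = Real.exp (-(m.noise lam * W t ω)) • u t := by
  set Z : ℝ → ℝ := fun t => ou W (m.noise lam) t ω with hZ
  -- Here `w = e^θ v`: the exponent `Z - σ W` is differentiable although `Z` and `W` separately need
  -- not be, and its derivative `-Z` cancels the term `Z v`.
  set θ : ℝ → ℝ := fun t => Z t - m.noise lam * W t ω with hθ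
  have hθd : ∀ t, HasDerivAt θ (-Z t) t := hasDerivAt_ou_sub hc hR
  have hθc : Continuous θ := continuous_iff_continuousAt.2 fun t => (hθd t).continuousAt
  have hex : ∀ t, ∃ d : m.A.domain, t ∈ lifeSpan τ ∩ Ioi 0 → m.incl d = v t ∧ m.A d = g t := by
    intro t
    by_cases ht : t ∈ lifeSpan τ ∩ Ioi 0
    · obtain ⟨d, h1, h2⟩ := (LinearPMap.mem_graph_iff _).1 (hd t ht).1
      exact ⟨d, fun _ => ⟨hinj (by rw [hs.emb_incl]; exact h1), h2⟩⟩
    · exact ⟨0, fun h => absurd h ht⟩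
  choose d hdd using hex
  refine ⟨fun t => Real.exp (θ t) • v t, fun t => Real.exp (θ t) • d t, ?_, ?_⟩
  · refine ⟨fun t ht => Icc_subset_lifeSpan ht, isOpen_lifeSpan_inter τ,
      (hθc.rexp.continuousOn).smul hvc, ?_, ?_, ?_⟩
    · intro t ht
      rw [map_smul, (hdd t ht).1]
    · refine ((hθc.rexp.continuousOn).smul hgc).congr fun t ht => ?_
      rw [LinearPMap.map_smul, (hdd t ht).2]
      rfl
    · intro t ht
      have h := (hθd t).exp.smul (hd t ht).2
      have e1 : (fun s => m.emb (Real.exp (θ s) • v s)) =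
          fun s => Real.exp (θ s) • m.emb (v s) := by ext s; rw [map_smul]
      rw [e1]
      convert! h using 1
      rw [map_smul, Lmap_apply, (hdd t ht).1, (hdd t ht).2]
      have e2 : Real.exp (m.noise lam * W t ω) * Real.exp (θ t) = Real.exp (Z t) := by
        rw [← Real.exp_add, hθ]; ring_nf
      have e3 : Real.exp (Z t) * Real.exp (-Z t) = 1 := by rw [← Real.exp_add]; simp
      simp only [map_smul, _root_.smul_apply, smul_add, smul_smul]
      rw [show Real.exp (m.noise lam * W t ω) * (Real.exp (θ t) * Real.exp (θ t)) =
        Real.exp (Z t) * Real.exp (θ t) by rw [← e2]; ring]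
      rw [show Real.exp (θ t) * (Real.exp (-ou W (m.noise lam) t ω) *
        (Real.exp (ou W (m.noise lam) t ω) * Real.exp (ou W (m.noise lam) t ω))) =
        Real.exp (Z t) * Real.exp (θ t) * (Real.exp (Z t) * Real.exp (-Z t)) by rw [hZ]; ring, e3]
      rw [hZ]
      module
  · intro t ht
    simp only
    rw [hv t ht, smul_smul, ← Real.exp_add, hθ, hZ]
    ring_nf

/-- The transformation `Y = e^{-σ W} X` of a solution of the reduced equation. -/
lemma hasDerivAt_reduced {W : ℝ → Ω → ℝ} {ω : Ω} {R : ℝ}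
    (hc : Continuous fun t => W t ω) (hR : ∀ s, |W s ω| ≤ R * (1 + |s|)) {X : ℝ → ℝ} {t : ℝ}
    (hX : HasDerivAt (fun s => Real.exp (-ou W (m.noise lam) s ω) * X s)
      (m.β lam 1 * (Real.exp (-ou W (m.noise lam) t ω) * X t)
        + ou W (m.noise lam) t ω * (Real.exp (-ou W (m.noise lam) t ω) * X t)
        + Real.exp (-ou W (m.noise lam) t ω)
            * (X t * m.Fc lam (m.Phi N W lam (X t) t ω))) t) :
    HasDerivAt (fun t => Real.exp (-(m.noise lam * W t ω)) * X t)
      (m.β lam 1 * (Real.exp (-(m.noise lam * W t ω)) * X t) -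
      Real.exp (m.noise lam * W t ω) * (Real.exp (-(m.noise lam * W t ω)) * X t) ^ 3 *
        ⟪m.forcing lam, (m.profile lam N (m.scaledMterm W lam ω) t : H)⟫) t := by
  set Z : ℝ → ℝ := fun t => ou W (m.noise lam) t ω with hZ
  have h := (hasDerivAt_ou_sub (σ := m.noise lam) hc hR t).exp.mul hX
  have e1 : (fun t => Real.exp (-(m.noise lam * W t ω)) * X t) =
      (fun t => Real.exp (ou W (m.noise lam) t ω - m.noise lam * W t ω)) *
        fun s => Real.exp (-ou W (m.noise lam) s ω) * X s := by
    ext s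
    simp only [Pi.mul_apply]
    rw [← mul_assoc, ← Real.exp_add]
    ring_nf
  rw [e1]
  convert! h using 1
  rw [hs.Fc_eq, hs.emb_Phi, inner_smul_right]
  have e2 : Real.exp (ou W (m.noise lam) t ω - m.noise lam * W t ω) =
      Real.exp (Z t) * Real.exp (-(m.noise lam * W t ω)) := by
    rw [← Real.exp_add, hZ, sub_eq_add_neg]
  have e3 : Real.exp (Z t) * Real.exp (-Z t) = 1 := by rw [← Real.exp_add]; simp
  have e4 : Real.exp (m.noise lam * W t ω) * Real.exp (-(m.noise lam * W t ω)) = 1 := by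
    rw [← Real.exp_add]; simp
  rw [e2]
  change _ = Real.exp (Z t) * Real.exp (-(m.noise lam * W t ω)) * -Z t *
    (Real.exp (-Z t) * X t) + Real.exp (Z t) * Real.exp (-(m.noise lam * W t ω)) *
    (m.β lam 1 * (Real.exp (-Z t) * X t) + Z t * (Real.exp (-Z t) * X t) +
      Real.exp (-Z t) * _)
  generalize Real.exp (Z t) = a at *
  generalize Real.exp (-Z t) = a' at *
  generalize Real.exp (m.noise lam * W t ω) = f at *
  generalize Real.exp (-(m.noise lam * W t ω)) = f' at *
  generalize ⟪m.forcing lam, (m.profile lam N (m.scaledMterm W lam ω) t : H)⟫ = S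
  linear_combination (-(m.β lam 1 * f' * X t) + f' ^ 2 * X t ^ 3 * S) * e3
    - (f' ^ 2 * X t ^ 3 * S) * e4

end SpectralBounds

end Pathwise

end Model

/-! ### The approximation theorem along a single path. -/

namespace Model

section Pathwise

variable {H V : Type*} [NormedAddCommGroup H] [InnerProductSpace ℝ H]
  [NormedAddCommGroup V] [NormedSpace ℝ V] {m : Model H V}
  {Ω : Type*} {N : ℕ+} {c C η δ κ : ℝ}

/-- `u(·, ω)` is a classical solution of the transformed equation along the path of `ω`. -/
def IsClassicalAlong (m : Model H V) (W : ℝ → Ω → ℝ) (lam : ℝ) (u : ℝ → Ω → V)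
    (τ : Ω → WithTop ℝ≥0) (ω : Ω) : Prop :=
  ∃ (v : ℝ → V) (g : ℝ → H),
    (∀ t ∈ lifeSpan (τ ω), v t = Real.exp (-ou W (m.noise lam) t ω) • u t ω) ∧
    ContinuousOn v (lifeSpan (τ ω)) ∧
    ContinuousOn g (lifeSpan (τ ω) ∩ Ioi 0) ∧
    ∀ t ∈ lifeSpan (τ ω) ∩ Ioi 0,
      (m.emb (v t), g t) ∈ m.A.graph ∧
      HasDerivAt (fun s => m.emb (v s))
        (-g t + m.P lam (v t) + ou W (m.noise lam) t ω • m.emb (v t)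
          + Real.exp (-ou W (m.noise lam) t ω) •
              m.B (Real.exp (ou W (m.noise lam) t ω) • v t)
                (Real.exp (ou W (m.noise lam) t ω) • v t)) t

/-- `X(·, ω)` solves the transformed reduced equation along the path of `ω`. -/
def IsReducedAlong (m : Model H V) (N : ℕ+) (W : ℝ → Ω → ℝ) (lam : ℝ) (X : ℝ → Ω → ℝ) (ω : Ω) :
    Prop :=
  ∀ t > 0, HasDerivAt (fun s => Real.exp (-ou W (m.noise lam) s ω) * X s ω)
    (m.β lam 1 * (Real.exp (-ou W (m.noise lam) t ω) * X t ω)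
      + ou W (m.noise lam) t ω * (Real.exp (-ou W (m.noise lam) t ω) * X t ω)
      + Real.exp (-ou W (m.noise lam) t ω)
          * (X t ω * m.Fc lam (m.Phi N W lam (X t ω) t ω))) t

lemma high_smul (lam a : ℝ) (u : V) : m.high lam (a • u) = a • m.high lam u := by
  rw [high, high, low, low, map_smul, inner_smul_left, smul_sub, smul_smul]
  rfl

lemma low_smul (lam a : ℝ) (u : V) : m.low lam (a • u) = a * m.low lam u := by
  rw [low, low, map_smul, inner_smul_left]
  rfl

set_option maxHeartbeats 1000000 in
/-- The approximation result along every path of the noise with controlled growth, with constants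
depending on the path only through its growth. -/
lemma exists_pathwise_bound (hinj : Function.Injective m.emb)
    (hsb : ∀ lam ∈ Ioc m.lamC m.lamS, m.SpectralBounds lam N c C η δ κ)
    {ρ R K T : ℝ} (hρ : 0 < ρ) (hR : 0 < R) (hK : 0 < K) (hT : 0 < T) :
    ∃ εs > (0 : ℝ), ∃ C' > (0 : ℝ), ∀ lam ∈ Ioc m.lamC m.lamS, m.β lam 1 ≤ εs →
      ∀ (W : ℝ → Ω → ℝ) (u : ℝ → Ω → V) (τ : Ω → WithTop ℝ≥0) (X : ℝ → Ω → ℝ) (ω : Ω),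
      W 0 ω = 0 → (Continuous fun t => W t ω) →
      (∀ t, |m.noise lam * W t ω| ≤ R * (1 + m.β lam 1 * |t|)) →
      0 < τ ω → m.IsClassicalAlong W lam u τ ω →
      (τ ω ≠ ⊤ → ∀ r < ρ, ∃ t ∈ lifeSpan (τ ω), r < ‖u t ω‖) →
      ContinuousOn (fun t => X t ω) (Ici 0) → m.IsReducedAlong N W lam X ω →
      X 0 ω = m.low lam (u 0 ω) →
      |m.low lam (u 0 ω)| ≤ K * √(m.β lam 1) →
      ‖m.emb (m.high lam (u 0 ω))‖ ≤ K * m.β lam 1 →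
      ‖m.high lam (u 0 ω)‖ ≤ K * m.β lam 1 →
      ‖m.emb (m.high lam (u 0 ω) - m.Phi N W lam (X 0 ω) 0 ω)‖ ≤ K * m.β lam 1 ^ (3 / 2 : ℝ) →
      ((Real.toNNReal (T / m.β lam 1) : ℝ≥0) : WithTop ℝ≥0) < τ ω ∧
        ∀ t ∈ Icc 0 (T / m.β lam 1),
          |m.low lam (u t ω) - X t ω| ≤ C' * m.β lam 1 ∧
          ‖m.emb (m.high lam (u t ω) - m.Phi N W lam (X t ω) t ω)‖
            ≤ C' * m.β lam 1 ^ (3 / 2 : ℝ) := by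
  rcases (Ioc m.lamC m.lamS).eq_empty_or_nonempty with hne | ⟨lam₀, hlam₀⟩
  · exact ⟨1, one_pos, 1, one_pos, fun lam hlam => by rw [hne] at hlam; exact hlam.elim⟩
  have hs₀ := hsb lam₀ hlam₀
  have hc := hs₀.c_pos
  have hC := hs₀.C_pos
  have hη := hs₀.η_lt
  have hδ := hs₀.δ_pos
  have hκ := hs₀.κ_nonneg
  have hη' : 0 < 1 - η := by linarith
  -- Each constant depends only on the previous ones: `G` bounds `e^g`, `C₁` the amplitudes over
  -- `s`, `Λ` is the barrier level, `C₂` bounds the stable part over `s²`, `M` the profile, `k` the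
  -- coupling, `A₁` and `A₂` the squared errors, and `Q` bounds `‖u‖_V` over `s`.
  obtain ⟨G, hG⟩ : ∃ G, G = Real.exp (R * (1 + T)) := ⟨_, rfl⟩
  have hG0 : 0 < G := hG ▸ Real.exp_pos _
  obtain ⟨C₁, hC₁⟩ : ∃ C₁, C₁ = 2 * K * Real.exp T := ⟨_, rfl⟩
  have hC₁0 : 0 < C₁ := by rw [hC₁]; positivity
  obtain ⟨Λ, hΛ⟩ : ∃ Λ, Λ = C * (K + 1) ^ 2 +
    (G * (‖m.B‖ * (C₁ * κ + 1) ^ 2)) ^ 2 / (4 * (1 - η) * δ) + 1 := ⟨_, rfl⟩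
  have hΛ0 : 0 < Λ := by rw [hΛ]; positivity
  have hΛ1 : C * (K + 1) ^ 2 ≤ Λ := by
    have : 0 ≤ (G * (‖m.B‖ * (C₁ * κ + 1) ^ 2)) ^ 2 / (4 * (1 - η) * δ) := by positivity
    linarith
  have hΛ2 : (G * (‖m.B‖ * (C₁ * κ + 1) ^ 2)) ^ 2 < 4 * (1 - η) * δ * Λ := by
    rw [← div_lt_iff₀' (by positivity)]
    have : 0 < C * (K + 1) ^ 2 := by positivity
    linarith
  obtain ⟨C₂, hC₂⟩ : ∃ C₂, C₂ = √(Λ / c) := ⟨_, rfl⟩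
  have hC₂0 : 0 ≤ C₂ := hC₂ ▸ Real.sqrt_nonneg _
  obtain ⟨M, hM⟩ : ∃ M, M = (Finset.Icc 2 N).card * (‖m.B‖ * κ ^ 2 * (G / (δ / 2))) := ⟨_, rfl⟩
  obtain ⟨k, hk⟩ : ∃ k, k = G * (2 * C₁ * (‖m.B‖ * κ ^ 2) + ‖m.B‖ * C₂ ^ 2 +
    2 * C₁ * ‖m.B‖ * κ * C₂ + 2 * C₁ ^ 4 * (‖m.B‖ * κ ^ 2) * M ^ 2) := ⟨_, rfl⟩
  have hk0 : 0 ≤ k := by rw [hk]; positivity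
  obtain ⟨A₁, hA₁⟩ : ∃ A₁, A₁ = (K ^ 2 + 1) * Real.exp ((2 + k + 4 * (k ^ 2 / δ)) * T) := ⟨_, rfl⟩
  have hA₁0 : 0 ≤ A₁ := by rw [hA₁]; positivity
  obtain ⟨A₂, hA₂⟩ : ∃ A₂, A₂ = K ^ 2 + 2 * (k ^ 2 / δ) * (A₁ + 1) / δ := ⟨_, rfl⟩
  have hA₂0 : 0 ≤ A₂ := by rw [hA₂]; positivity
  obtain ⟨Q, hQ⟩ : ∃ Q, Q = G * (C₁ * κ + C₂) + 1 := ⟨_, rfl⟩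
  have hQ0 : 0 < Q := by rw [hQ]; positivity
  -- The four thresholds give, in order: `s ≤ 1`; the smallness condition of the barrier; decay rate
  -- at least `δ/2` in the integrals `M_{11}^n`; and `‖u‖_V ≤ ρ/2`.
  refine ⟨min (min 1 (c / Λ)) (min (δ / (2 * R)) ((ρ / (2 * Q)) ^ 2)),
    by positivity, G * (A₁ + A₂ + 1), by positivity, ?_⟩
  intro lam hlam hβ W u τ X ω hW0 hWc hWR hτ ⟨v, gA, hv, hvc, hgc, hd⟩ hsurv hXc hX hX0
    hx0 hsH hsV hr0
  have hs := hsb lam hlam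
  have hε := hs.β_pos
  set ε := m.β lam 1 with hεdef
  set s := √ε with hsdef
  have hs0 : 0 < s := Real.sqrt_pos.2 hε
  have hsε : ε = s ^ 2 := (Real.sq_sqrt hε.le).symm
  have hε1 : ε ≤ 1 := hβ.trans ((min_le_left _ _).trans (min_le_left _ _))
  have hεΛ : ε ≤ c / Λ := hβ.trans ((min_le_left _ _).trans (min_le_right _ _))
  have hεR : ε ≤ δ / (2 * R) := hβ.trans ((min_le_right _ _).trans (min_le_left _ _))
  have hερ : ε ≤ (ρ / (2 * Q)) ^ 2 := hβ.trans ((min_le_right _ _).trans (min_le_right _ _))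
  have hs1 : s ≤ 1 := Real.sqrt_le_one.2 hε1
  have hnoise : m.noise lam = s := rfl
  rw [rpow_three_halves_eq hε.le] at hr0 ⊢
  set b := T / ε with hb
  have hb0 : 0 ≤ b := by positivity
  have hεb : ε * b = T := by rw [hb]; field_simp
  set g : ℝ → ℝ := fun t => m.noise lam * W t ω with hg
  have hgc' : Continuous g := continuous_const.mul hWc
  have hg0 : g 0 = 0 := by rw [hg]; simp [hW0]
  have hgb : ∀ t ∈ Icc 0 b, |g t| ≤ R * (1 + T) := by
    intro t ht
    refine (hWR t).trans ?_
    rw [abs_of_nonneg ht.1, ← hεb]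
    have := ht.2
    gcongr
  have hgG : ∀ t ∈ Icc 0 b, Real.exp (g t) ≤ G := fun t ht =>
    hG ▸ Real.exp_le_exp.2 (abs_le.1 (hgb t ht)).2
  -- The constant `R / s` blows up as `ε → 0`, but it serves only to make the integral defining `Z`
  -- converge, never in an estimate.
  have hWlin : ∀ t, |W t ω| ≤ (R / s) * (1 + |t|) := by
    intro t
    have h1 := hWR t
    rw [hnoise, abs_mul, abs_of_pos hs0] at h1
    rw [div_mul_eq_mul_div, le_div_iff₀ hs0, mul_comm]
    refine h1.trans ?_
    gcongr
    exact mul_le_of_le_one_left (abs_nonneg _) hε1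
  obtain ⟨w, D, hw, hwu⟩ := hs.exists_isPathSolution hinj hWc hWlin hv hvc hgc hd
  change m.IsPathSolution lam g (lifeSpan (τ ω)) w D at hw
  change ∀ t ∈ lifeSpan (τ ω), w t = Real.exp (-g t) • u t ω at hwu
  set J := lifeSpan (τ ω) with hJ
  have h0J : (0 : ℝ) ∈ J := ⟨le_rfl, by simpa using hτ⟩
  have hw0 : w 0 = u 0 ω := by rw [hwu 0 h0J, hg0]; simp
  have huw : ∀ t ∈ J, u t ω = Real.exp (g t) • w t := by
    intro t ht
    rw [hwu t ht, smul_smul, ← Real.exp_add]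
    simp
  have hexpT : ∀ t ∈ Icc 0 b, Real.exp (2 * ε * t) ≤ Real.exp T ^ 2 := by
    intro t ht
    rw [← Real.exp_nat_mul]
    apply Real.exp_le_exp.2
    have := mul_le_mul_of_nonneg_left ht.2 hε.le
    push_cast
    linarith
  have hnorm0 : ‖m.emb (w 0)‖ ^ 2 ≤ 2 * K ^ 2 * s ^ 2 := by
    rw [hs.norm_sq_eq, hw0, ← hs.emb_high]
    change m.low lam (u 0 ω) ^ 2 + _ ≤ _
    have h1 : m.low lam (u 0 ω) ^ 2 ≤ (K * s) ^ 2 := sq_le_sq' (abs_le.1 hx0).1 (abs_le.1 hx0).2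
    have h2 : ‖m.emb (m.high lam (u 0 ω))‖ ≤ K * s := hsH.trans (by
      gcongr
      rw [hsε, sq]
      exact mul_le_of_le_one_left hs0.le hs1)
    have h3 : ‖m.emb (m.high lam (u 0 ω))‖ ^ 2 ≤ (K * s) ^ 2 := by gcongr
    linarith
  have hlow : ∀ t ∈ J ∩ Icc 0 b, |m.low lam (w t)| ≤ C₁ * s := by
    intro t ht
    refine (hs.norm_low_le _).trans ?_
    have h1 := hw.norm_sq_le hs ht.1 ht.2.1
    refine le_of_sq_le_sq ?_ (by positivity)
    calc ‖m.emb (w t)‖ ^ 2 ≤ 2 * K ^ 2 * s ^ 2 * Real.exp T ^ 2 := by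
          refine h1.trans ?_
          have := hexpT t ht.2
          gcongr
      _ ≤ 4 * K ^ 2 * s ^ 2 * Real.exp T ^ 2 := by gcongr; norm_num
      _ = (C₁ * s) ^ 2 := by rw [hC₁]; ring
  have hhigh : ∀ t ∈ J ∩ Icc 0 b, ‖m.high lam (w t)‖ ≤ C₂ * s ^ 2 := by
    intro t ht
    have h1 := hw.norm_high_sq_le hs hs0 hC₁0.le hK.le hG0.le hgG hlow
      (by rw [hw0, ← hsε]; exact hsV) hΛ1 hΛ2
      (by rw [← hsε, mul_comm, ← le_div_iff₀ hΛ0]; exact hεΛ) ht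
    refine le_of_sq_le_sq ?_ (by positivity)
    rw [mul_pow, hC₂, Real.sq_sqrt (by positivity), div_mul_eq_mul_div, le_div_iff₀ hc]
    calc ‖m.high lam (w t)‖ ^ 2 * c = c * ‖m.high lam (w t)‖ ^ 2 := mul_comm _ _
      _ ≤ Λ * s ^ 4 := h1
      _ = _ := by ring
  -- If `τ ≤ T/ε`, the norm would exceed `ρ/2` at some time before `τ`, against the a priori bound
  -- `‖u‖_V ≤ Q s ≤ ρ/2`.
  have hmain : ((Real.toNNReal b : ℝ≥0) : WithTop ℝ≥0) < τ ω := by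
    by_contra hcon
    rw [not_lt] at hcon
    have hne : τ ω ≠ ⊤ := ne_top_of_le_ne_top WithTop.coe_ne_top hcon
    obtain ⟨t, ht, hlt⟩ := hsurv hne (ρ / 2) (by linarith)
    have htb : t ∈ Icc 0 b := by
      refine ⟨ht.1, ?_⟩
      have h1 := ht.2.trans_le hcon
      rw [WithTop.coe_lt_coe, Real.toNNReal_lt_toNNReal_iff_of_nonneg ht.1] at h1
      exact h1.le
    have h1 : ‖w t‖ ≤ (C₁ * κ + C₂) * s := by
      refine (hs.norm_le _).trans ?_
      have h2 := hlow t ⟨ht, htb⟩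
      have h3 := hhigh t ⟨ht, htb⟩
      have h4 : C₂ * s ^ 2 ≤ C₂ * s := by
        gcongr
        rw [sq]
        exact mul_le_of_le_one_left hs0.le hs1
      calc _ ≤ C₁ * s * κ + C₂ * s := by gcongr; exact h3.trans h4
        _ = _ := by ring
    have h2 : ‖u t ω‖ ≤ Q * s := by
      rw [huw t ht, norm_smul, Real.norm_eq_abs, abs_of_pos (Real.exp_pos _)]
      have := hgG t htb
      calc _ ≤ G * ((C₁ * κ + C₂) * s) := by gcongr
        _ ≤ G * ((C₁ * κ + C₂) * s) + s := by linarith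
        _ = Q * s := by rw [hQ]; ring
    have h3 : s ≤ ρ / (2 * Q) := by
      rw [hsε] at hερ
      exact le_of_sq_le_sq hερ (by positivity)
    have h4 : Q * s ≤ ρ / 2 := by
      calc Q * s ≤ Q * (ρ / (2 * Q)) := by gcongr
        _ = ρ / 2 := by field_simp
    linarith
  refine ⟨hmain, ?_⟩
  have hbJ : b ∈ J := ⟨hb0, hmain⟩
  have hsubJ := hw.mem b hbJ
  set a := m.scaledMterm W lam ω with ha
  have hgap : ∀ n ∈ Finset.Icc 2 N, δ / 2 ≤ (2 * ε - m.β lam n) - R * ε := by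
    intro n hn
    have h1 := hs.β_le (Finset.mem_Icc.1 hn).1
    have h2 : R * ε ≤ δ / 2 := by
      rw [le_div_iff₀ (by positivity)] at hεR
      linarith
    linarith
  have ha0 : ∀ t ∈ Icc 0 b, ∀ n ∈ Finset.Icc 2 N, 0 ≤ a n t := fun t _ n _ => expAverage_nonneg t
  have had : ∀ t ∈ Icc 0 b, ∀ n ∈ Finset.Icc 2 N,
      HasDerivAt (a n) (-(2 * m.β lam 1 - m.β lam n) * a n t + Real.exp (g t)) t :=
    fun t _ n hn => hasDerivAt_expAverage hgc' hWR (lt_of_lt_of_le (by positivity) (hgap n hn)) t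
  have haM : ∀ t ∈ Icc 0 b, ‖(m.profile lam N a t : H)‖ ≤ M := by
    intro t ht
    rw [hM]
    refine hs.norm_profile_le fun n hn => ?_
    rw [abs_of_nonneg (ha0 t ht n hn)]
    have hpos : 0 < (2 * ε - m.β lam n) - R * ε := lt_of_lt_of_le (by positivity) (hgap n hn)
    refine (expAverage_le (ε := ε) hWR hR.le hε.le hpos).trans ?_
    have h1 := hgap n hn
    have h2 : Real.exp (R * (1 + ε * |t|)) ≤ G := by
      rw [hG]
      apply Real.exp_le_exp.2
      rw [abs_of_nonneg ht.1, ← hεb]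
      have := ht.2
      gcongr
    gcongr
  set Y : ℝ → ℝ := fun t => Real.exp (-g t) * X t ω with hY
  have hYc : ContinuousOn Y (Icc 0 b) :=
    (hgc'.neg.rexp.continuousOn).mul (hXc.mono fun t ht => ht.1)
  have hYd : ∀ t ∈ Ioo 0 b, HasDerivAt Y (m.β lam 1 * Y t -
      Real.exp (g t) * Y t ^ 3 * ⟪m.forcing lam, (m.profile lam N a t : H)⟫) t :=
    fun t ht => hs.hasDerivAt_reduced (X := fun t => X t ω) hWc hWlin (hX t ht.1)
  have hY0 : Y 0 = m.low lam (w 0) := by rw [hY]; simp [hg0, hX0, hw0]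
  have hYb : ∀ t ∈ Icc 0 b, |Y t| ≤ C₁ * s := by
    intro t ht
    refine abs_le_of_sq_le_sq ?_ (by positivity)
    have h1 := hs.reduced_sq_le hYc ha0 hYd ht
    have h2 : Y 0 ^ 2 ≤ (K * s) ^ 2 := by
      rw [hY0, hw0]
      exact sq_le_sq' (abs_le.1 hx0).1 (abs_le.1 hx0).2
    calc Y t ^ 2 ≤ (K * s) ^ 2 * Real.exp T ^ 2 := by
          refine h1.trans ?_
          have := hexpT t ht
          gcongr
      _ ≤ 4 * ((K * s) ^ 2 * Real.exp T ^ 2) := by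
          have : 0 ≤ (K * s) ^ 2 * Real.exp T ^ 2 := by positivity
          linarith
      _ = (C₁ * s) ^ 2 := by rw [hC₁]; ring
  -- Because `Φ` is quadratic in `X`, the error for `u` is exactly `e^g` times the error for `w`.
  have hdiff : ∀ t ∈ J, m.emb (m.high lam (u t ω) - m.Phi N W lam (X t ω) t ω) =
      Real.exp (g t) • (m.emb (m.high lam (w t)) - Y t ^ 2 • (m.profile lam N a t : H)) := by
    intro t ht
    rw [map_sub, hs.emb_Phi, huw t ht, high_smul, map_smul, smul_sub, smul_smul]
    congr 2
    rw [hY]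
    simp only
    have e : Real.exp (g t) * Real.exp (-g t) = 1 := by rw [← Real.exp_add]; simp
    change X t ω ^ 2 * Real.exp (-g t) = _
    linear_combination -(X t ω ^ 2 * Real.exp (-g t)) * e
  have hr0' : ‖m.emb (m.high lam (w 0)) - Y 0 ^ 2 • (m.profile lam N a 0 : H)‖ ≤ K * s ^ 3 := by
    rw [hdiff 0 h0J, hg0, Real.exp_zero, one_smul] at hr0
    exact hr0
  intro t ht
  have hres := hs.exists_comparison_bound hw (C₁ := C₁) (C₂ := C₂) (K₀ := K) (M := M) (k := k)
    (T := T) (G := G) hbJ hsε hs0 hs1 (by rw [← hsε]; exact hεb.le) hC₁0.le (by positivity) hG0.le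
    hgG (fun t ht => hlow t ⟨hsubJ ht, ht⟩) (fun t ht => hhigh t ⟨hsubJ ht, ht⟩) hYc hYb ha0 had haM
    hYd hY0 hr0' hk.ge ht
  rw [← hA₁, ← hA₂] at hres
  -- This lets `A₁ + A₂ + 1` serve for both errors without square roots.
  have hbig : ∀ A, 0 ≤ A → A ≤ A₁ + A₂ → A ≤ (A₁ + A₂ + 1) ^ 2 := fun A h0 h => by nlinarith
  have hGt := hgG t ht
  constructor
  · have e : m.low lam (u t ω) - X t ω = Real.exp (g t) * (m.low lam (w t) - Y t) := by
      rw [huw t (hsubJ ht), low_smul, hY]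
      simp only
      rw [mul_sub, ← mul_assoc, ← Real.exp_add]
      simp
    have h1 : |m.low lam (w t) - Y t| ≤ (A₁ + A₂ + 1) * s ^ 2 := by
      refine abs_le_of_sq_le_sq ?_ (by positivity)
      refine hres.1.trans ?_
      calc A₁ * s ^ 4 ≤ (A₁ + A₂ + 1) ^ 2 * s ^ 4 := by
            gcongr
            exact hbig _ hA₁0 (by linarith)
        _ = _ := by ring
    rw [e, abs_mul, abs_of_pos (Real.exp_pos _), mul_assoc, hsε]
    gcongr
  · have h1 : ‖m.emb (m.high lam (w t)) - Y t ^ 2 • (m.profile lam N a t : H)‖ ≤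
        (A₁ + A₂ + 1) * s ^ 3 := by
      refine le_of_sq_le_sq ?_ (by positivity)
      refine hres.2.trans ?_
      calc A₂ * s ^ 6 ≤ (A₁ + A₂ + 1) ^ 2 * s ^ 6 := by
            gcongr
            exact hbig _ hA₂0 (by linarith)
        _ = _ := by ring
    rw [hdiff t (hsubJ ht), norm_smul, Real.norm_eq_abs, abs_of_pos (Real.exp_pos _), mul_assoc]
    gcongr

end Pathwise

end Model

end PitchforkSPDE

end

/-! ### From single paths to probabilities. -/

lemma PitchforkSPDE.IsTwoSidedBrownian.hasBrownianIncrements {Ω : Type*} [MeasurableSpace Ω]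
    {W : ℝ → Ω → ℝ} {μ : Measure Ω} (hW : IsTwoSidedBrownian W μ) : HasBrownianIncrements W μ :=
  ⟨hW.zero, hW.law, hW.cont⟩

theorem theorem4p1
    {p d : ℕ} {D : Set (EuclideanSpace ℝ (Fin p))} (hD : IsOpen D) (ν : Fin d → ℝ)
    (H : Submodule ℝ (VecL2 D d)) [CompleteSpace H]
    {V : Type*} [NormedAddCommGroup V] [NormedSpace ℝ V] [CompleteSpace V]
    (m : Model H V) (N : ℕ+)
    (hm : m.FunctionalSetting) (hL1 : m.CondL1 ν) (hL2 : m.CondL2) (hA3 : m.CondA3 N)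
    {Ω : Type*} [mΩ : MeasurableSpace Ω] (μ : Measure Ω) [IsProbabilityMeasure μ]
    (𝓕 : Filtration ℝ≥0 mΩ) (W : ℝ → Ω → ℝ)
    (hW : IsTwoSidedBrownian W μ) (h𝓕 : IsCompatible 𝓕 W μ)
    (hP : m.CondP N W μ)
    (ρ : ℝ) (hρ : 0 < ρ)
    (u : ℝ → ℝ → Ω → V) (τ : ℝ → Ω → WithTop ℝ≥0) (X : ℝ → ℝ → Ω → ℝ)
    (hu : ∀ lam ∈ Ioc m.lamC m.lamS, m.IsSPDESolution 𝓕 W μ lam (u lam) (τ lam))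
    (hτ : ∀ lam ∈ Ioc m.lamC m.lamS, Model.SurvivesInBall μ ρ (u lam) (τ lam))
    (hX : ∀ lam ∈ Ioc m.lamC m.lamS, m.IsReducedSolution N 𝓕 W μ lam (X lam))
    (hX0 : ∀ lam ∈ Ioc m.lamC m.lamS, ∀ᵐ ω ∂μ, X lam 0 ω = m.low lam (u lam 0 ω))
    (hinit : ∀ χ ∈ Ioo (0 : ℝ) 1, ∃ K > (0 : ℝ), ∃ ε₀ > (0 : ℝ),
      ∀ lam ∈ Ioc m.lamC m.lamS, m.β lam 1 ≤ ε₀ →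
        ENNReal.ofReal (1 - χ) ≤ μ {ω |
          |m.low lam (u lam 0 ω)| ≤ K * √(m.β lam 1) ∧
          ‖m.emb (m.high lam (u lam 0 ω))‖ ≤ K * m.β lam 1 ∧
          ‖m.high lam (u lam 0 ω)‖ ≤ K * m.β lam 1 ∧
          ‖m.emb (m.high lam (u lam 0 ω) - m.Phi N W lam (X lam 0 ω) 0 ω)‖
            ≤ K * m.β lam 1 ^ (3 / 2 : ℝ)}) :
    ∀ T > (0 : ℝ), ∀ χ ∈ Ioo (0 : ℝ) 1, ∃ εs > (0 : ℝ), ∃ C > (0 : ℝ),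
      ∀ lam ∈ Ioc m.lamC m.lamS, m.β lam 1 ≤ εs →
        ENNReal.ofReal (1 - χ) ≤ μ {ω |
          ((Real.toNNReal (T / m.β lam 1) : ℝ≥0) : WithTop ℝ≥0) < τ lam ω ∧
          ∀ t ∈ Icc 0 (T / m.β lam 1),
            |m.low lam (u lam t ω) - X lam t ω| ≤ C * m.β lam 1 ∧
            ‖m.emb (m.high lam (u lam t ω) - m.Phi N W lam (X lam t ω) t ω)‖
              ≤ C * m.β lam 1 ^ (3 / 2 : ℝ)} := by
  intro T hT χ hχ
  obtain ⟨c, C, η, δ, κ, hsb⟩ := Model.exists_spectralBounds hm hL1.condA1 hL1.condA2 hL1.symm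
    hL1.equiv_norm hL2 hA3
  -- Half of `χ` is allotted to the initial data, half to the growth of the noise.
  obtain ⟨K, hK, ε₀, hε₀, hinit⟩ := hinit (χ / 2) ⟨by linarith [hχ.1], by linarith [hχ.2]⟩
  obtain ⟨R, hR, hgrowth⟩ := exists_linear_growth_bound (half_pos hχ.1)
  obtain ⟨εs, hεs, C', hC', hpath⟩ :=
    Model.exists_pathwise_bound (Ω := Ω) hm.emb_inj hsb hρ hR hK hT
  refine ⟨min ε₀ εs, lt_min hε₀ hεs, C', hC', fun lam hlam hβ => ?_⟩
  have hε : 0 < m.β lam 1 := (hsb lam hlam).β_pos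
  have hS := hinit lam hlam (hβ.trans (min_le_left _ _))
  have hbad := hgrowth μ _ (hW.hasBrownianIncrements.scale hε)
  set good := {ω | ((Real.toNNReal (T / m.β lam 1) : ℝ≥0) : WithTop ℝ≥0) < τ lam ω ∧
          ∀ t ∈ Icc 0 (T / m.β lam 1),
            |m.low lam (u lam t ω) - X lam t ω| ≤ C' * m.β lam 1 ∧
            ‖m.emb (m.high lam (u lam t ω) - m.Phi N W lam (X lam t ω) t ω)‖
              ≤ C' * m.β lam 1 ^ (3 / 2 : ℝ)}
  set bad := {ω | ¬ ∀ s, |√(m.β lam 1) * W (s / m.β lam 1) ω| ≤ R * (1 + |s|)}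
  set start := {ω |
          |m.low lam (u lam 0 ω)| ≤ K * √(m.β lam 1) ∧
          ‖m.emb (m.high lam (u lam 0 ω))‖ ≤ K * m.β lam 1 ∧
          ‖m.high lam (u lam 0 ω)‖ ≤ K * m.β lam 1 ∧
          ‖m.emb (m.high lam (u lam 0 ω) - m.Phi N W lam (X lam 0 ω) 0 ω)‖
            ≤ K * m.β lam 1 ^ (3 / 2 : ℝ)}
  have hsub : start ≤ᵐ[μ] (good ∪ bad : Set Ω) := by
    filter_upwards [hW.zero, hW.cont, (hu lam hlam).pos, (hu lam hlam).classical, hτ lam hlam,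
      (hX lam hlam).cont, (hX lam hlam).ode, hX0 lam hlam] with ω h1 h2 h3 h4 h5 h6 h7 h8 h9
    by_cases hb : ω ∈ bad
    · exact Or.inr hb
    · left
      have hgr : ∀ t, |m.noise lam * W t ω| ≤ R * (1 + m.β lam 1 * |t|) := by
        intro t
        have h10 : ∀ s, |√(m.β lam 1) * W (s / m.β lam 1) ω| ≤ R * (1 + |s|) := not_not.1 hb
        have h11 := h10 (m.β lam 1 * t)
        rwa [mul_div_cancel_left₀ _ hε.ne', abs_mul (m.β lam 1) t, abs_of_pos hε] at h11
      obtain ⟨i1, i2, i3, i4⟩ := h9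
      exact hpath lam hlam (hβ.trans (min_le_right _ _)) W (u lam) (τ lam) (X lam) ω h1 h2 hgr h3
        h4 h5 h6 h7 h8 i1 i2 i3 i4
  -- Only monotonicity and subadditivity of the measure are used, so none of the three events has to
  -- be measurable.
  have h1 : ENNReal.ofReal (1 - χ / 2) ≤ μ good + ENNReal.ofReal (χ / 2) :=
    hS.trans ((measure_mono_ae hsub).trans ((measure_union_le _ _).trans (by gcongr)))
  have h2 : ENNReal.ofReal (1 - χ) = ENNReal.ofReal (1 - χ / 2) - ENNReal.ofReal (χ / 2) := by
    rw [← ENNReal.ofReal_sub _ (by linarith [hχ.1])]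
    congr 1
    ring
  rw [h2]
  exact tsub_le_iff_right.2 h1
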